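/- Let $\widehat{\mathbb C}=\mathbb C\cup\{\infty\}$, and for $\alpha\subseteq\widehat{\mathbb C}$ let $\mathcal A_\alpha$ be the group of all Möbius transformations $g$ with $g(\alpha)=\alpha$. Identify $\widehat{\mathbb C}$ with the unit sphere $S\subset\mathbb R^3$ by stereographic projection. Let $G\simeq A_4$ be a group of Möbius transformations. After a Möbius change of coordinate, $G$ acts on $S$ by rotations which preserve a regular tetrahedron inscribed in $S$. Let $V$, $F$, $E\subset\widehat{\mathbb C}$ be the sets (in the original coordinate) of its vertices, of the central projections to $S$ of its face centres, and of the central projections to $S$ of its edge midpoints; and for $X\notin V\cup F\cup E$ let $B(X)$ be the $G$-orbit of $X$. If $\alpha$ is a finite union of $G$-orbits, its tetrahedral component index with respect to $G$ is $(\nu,\epsilon,k)\in\{0,1,2\}\times\{0,1\}\times\mathbb N$, where $\nu$, $\epsilon$ and $k$ are the numbers of orbits contained in $\alpha$ that belong to $\{V,F\}$, that equal $E$, and that are of the form $B(X)$, respectively. **Theorem.** (1) Every finite $\alpha\subseteq\widehat{\mathbb C}$ with $\mathcal A_\alpha\simeq A_4$ has a well-defined (existing and unique) tetrahedral component index with respect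 to $\mathcal A_\alpha$. (2) A triple $(\nu,\epsilon,k)\in\{0,1,2\}\times\{0,1\}\times\mathbb N$ is the tetrahedral component index, with respect to $\mathcal A_\alpha$, of some finite $\alpha\subseteq\widehat{\mathbb C}$ with $\mathcal A_\alpha\simeq A_4$ if and only if it is none of $(0,0,0)$, $(2,0,0)$, $(0,1,0)$, $(2,1,0)$. Equivalently, the occurring indices are $(1,0,0)$, $(1,1,0)$ and all $(\nu,\epsilon,k)$ with $k\ge1$. (3) Every finite $\alpha\subseteq\widehat{\mathbb C}$ with $\mathcal A_\alpha\simeq A_4$ and tetrahedral component index $(\nu,\epsilon,k)$ satisfies $|\alpha|=4\nu+6\epsilon+12k$. (4) $$\{|\alpha| : \alpha\subseteq\widehat{\mathbb C}\text{ finite},\ \mathcal A_\alpha\simeq A_4\}=\{x+12k : x\in\{0,4,6,8,10,14\},\ k\ge 1\}\cup\{4,10\}.$$ -/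

import Mathlib

open scoped Pointwise

noncomputable section

namespace MoebiusStabilizer

/-- The extended complex plane. -/
abbrev ExtPlane : Type := OnePoint ℂ

/-- The group of Möbius transformations `z ↦ (a z + b) / (c z + d)`, as a group of permutations of
the extended complex plane. -/
abbrev MoebiusGroup : Subgroup (Equiv.Perm ExtPlane) :=
  (MulAction.toPermHom (Matrix.GeneralLinearGroup (Fin 2) ℂ) ExtPlane).range

/-- The group of all Möbius transformations that leave `α` invariant. -/
def stab (α : Set ExtPlane) : Subgroup MoebiusGroup :=
  MulAction.stabilizer MoebiusGroup α

/-- Euclidean three-space. -/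
abbrev Space : Type := EuclideanSpace ℝ (Fin 3)

/-- Stereographic projection from the north pole `(0, 0, 1)`, which identifies the unit sphere of
`ℝ³` with the extended complex plane. It is only used at points of the unit sphere. -/
def stereo (x : Space) : ExtPlane :=
  if x 2 = 1 then OnePoint.infty else ((⟨x 0 / (1 - x 2), x 1 / (1 - x 2)⟩ : ℂ) : ExtPlane)

/-- Central projection of `ℝ³ ∖ {0}` to the unit sphere. -/
def centralProj (x : Space) : Space := ‖x‖⁻¹ • x

/-- A regular tetrahedron whose vertices lie on the unit sphere (so that its centre is `0`). -/
def IsInscribedRegular (T : Affine.Simplex ℝ Space 3) : Prop :=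
  (∀ i, ‖T.points i‖ = 1) ∧ T.Equilateral

/-- The vertices of `T`. -/
def vertexSet (T : Affine.Simplex ℝ Space 3) : Set Space := Set.range T.points

/-- The projections to the unit sphere of the centres of the faces of `T`. -/
def faceSet (T : Affine.Simplex ℝ Space 3) : Set Space :=
  {x | ∃ i, x = centralProj (T.faceOppositeCentroid i)}

/-- The projections to the unit sphere of the midpoints of the edges of `T`. -/
def edgeSet (T : Affine.Simplex ℝ Space 3) : Set Space :=
  {x | ∃ i j, i ≠ j ∧ x = centralProj (midpoint ℝ (T.points i) (T.points j))}

/-- The Möbius transformation `g` acts on the unit sphere as a rotation of `ℝ³` that maps the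
tetrahedron `T` onto itself. -/
def ActsAsRotationOf (T : Affine.Simplex ℝ Space 3) (g : MoebiusGroup) : Prop :=
  ∃ A ∈ Matrix.specialOrthogonalGroup (Fin 3) ℝ,
    Matrix.toEuclideanLin A '' vertexSet T = vertexSet T ∧
      ∀ x : Space, ‖x‖ = 1 → g • stereo x = stereo (Matrix.toEuclideanLin A x)

/-- `V`, `F`, `E` are the vertices, the projected face centres and the projected edge midpoints of a
regular tetrahedron fixed by `G`. A group of Möbius transformations isomorphic to `A₄` is a
group of rotations only after a Möbius change of coordinate `φ`; the three sets are transported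
back to the original coordinate. -/
def IsTetrahedralTriple (G : Subgroup MoebiusGroup) (V F E : Set ExtPlane) : Prop :=
  ∃ (φ : MoebiusGroup) (T : Affine.Simplex ℝ Space 3),
    IsInscribedRegular T ∧
    (∀ g ∈ G, ActsAsRotationOf T (φ⁻¹ * g * φ)) ∧
    V = φ • (stereo '' vertexSet T) ∧
    F = φ • (stereo '' faceSet T) ∧
    E = φ • (stereo '' edgeSet T)

/-- The orbits `B(X)` of the points `X` outside `V ∪ F ∪ E`. -/
def orbitsB (G : Subgroup MoebiusGroup) (V F E : Set ExtPlane) : Set (Set ExtPlane) :=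
  {O | ∃ X, X ∉ V ∪ F ∪ E ∧ O = MulAction.orbit G X}

/-- `G` is isomorphic to `A₄`, and `α` is a finite union of orbits of `G`, of which `ν` are among
`V` and `F`, `ε` are equal to `E` and `k` are of the form `B(X)`:
`(ν, ε, k)` is the tetrahedral component index of `α` with respect to `G`. -/
def HasTetrahedralIndex (G : Subgroup MoebiusGroup) (α : Set ExtPlane) (ν ε k : ℕ) : Prop :=
  Nonempty (G ≃* alternatingGroup (Fin 4)) ∧
  ∃ V F E : Set ExtPlane, IsTetrahedralTriple G V F E ∧
    ∃ 𝒪 : Set (Set ExtPlane), 𝒪.Finite ∧ 𝒪 ⊆ {V, F, E} ∪ orbitsB G V F E ∧ ⋃₀ 𝒪 = α ∧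
      (𝒪 ∩ {V, F}).ncard = ν ∧ (𝒪 ∩ {E}).ncard = ε ∧ (𝒪 ∩ orbitsB G V F E).ncard = k

/-- `α` is a finite subset of the extended complex plane whose stabilizer is isomorphic to `A₄`. -/
def HasStabilizerA4 (α : Set ExtPlane) : Prop :=
  α.Finite ∧ Nonempty (stab α ≃* alternatingGroup (Fin 4))

end MoebiusStabilizer

end

namespace MoebiusStabilizer

open OnePoint

/-! Every group `G` of Möbius transformations isomorphic to A₄ is conjugate to one explicit rotation
group `stdGroup` (`exists_conj_stdGroup`): its Klein four-group can be normalized to `{1, -z, 1/z,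
-1/z}`, and an element of order three is then determined up to that four-group, which is its own
centralizer. So a tetrahedral triple exists for every such `G`. A nontrivial Möbius transformation
has at most two fixed points, and for the elements of `G` these are opposite vertex and face points
or opposite edge points. Hence `V` and `F` are orbits of size 4, `E` is an orbit of size 6, and all
other orbits are free, of size 12. The index therefore counts the orbits in `α` of sizes 4, 6 and
12. It does not depend on the tetrahedron, and the formula for `|α|` follows.

Exclusion: `G` is normalized by a quarter turn outside `G` (`exists_normalizing`). This map
preserves orbit sizes, so it permutes `{V, F}` and fixes `E`. A union of special orbits containing
both or neither of `V`, `F` is invariant under it, and its stabilizer is larger than `G`.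

Realization with `k = 0`: `V` and `V ∪ E` have stabilizer exactly `G` (`stab_range_v_le`,
`stab_v_union_e_le`). The tool is that elements of a finite Möbius group with a common fixed point
commute.

Realization with `k ≥ 1`: every finite group containing `stdGroup` has algebraic coefficients
(`mem_algebraicMoebius`), and there are only countably many such transformations. A point `X` fixed
by no nontrivial one of them, together with further orbits avoiding all their translates of `X`,
gives a set each of whose symmetries must send `X` into its own `G`-orbit, and so lies in `G`. No
classification of finite Möbius groups is needed. -/

/-! ### Möbius transformations: normal forms and fixed points -/

theorem moebius_ext {g h : MoebiusGroup} (H : ∀ x : ExtPlane, g • x = h • x) : g = h := by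
  apply Subtype.ext
  apply Equiv.ext
  exact H

/-- The transformation `z ↦ (a z + b) / (c z + d)`. -/
noncomputable def mob (a b c d : ℂ) (h : a * d - b * c ≠ 0) : MoebiusGroup :=
  ⟨MulAction.toPermHom (GL (Fin 2) ℂ) ExtPlane
    (Matrix.GeneralLinearGroup.mkOfDetNeZero !![a, b; c, d] (by simpa [Matrix.det_fin_two] using h)),
    ⟨_, rfl⟩⟩

theorem mob_smul_infty (a b c d : ℂ) (h : a * d - b * c ≠ 0) :
    mob a b c d h • (∞ : ExtPlane) = if c = 0 then ∞ else ((a / c : ℂ) : ExtPlane) := by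
  change (Matrix.GeneralLinearGroup.mkOfDetNeZero !![a, b; c, d] _) • (∞ : ExtPlane) = _
  rw [OnePoint.smul_infty_eq_ite]
  simp [Matrix.GeneralLinearGroup.mkOfDetNeZero]

theorem mob_smul_coe (a b c d : ℂ) (h : a * d - b * c ≠ 0) (z : ℂ) :
    mob a b c d h • (z : ExtPlane) =
      if c * z + d = 0 then ∞ else (((a * z + b) / (c * z + d) : ℂ) : ExtPlane) := by
  change (Matrix.GeneralLinearGroup.mkOfDetNeZero !![a, b; c, d] _) • (z : ExtPlane) = _
  rw [OnePoint.smul_some_eq_ite]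
  simp [Matrix.GeneralLinearGroup.mkOfDetNeZero]

theorem exists_eq_mob (g : MoebiusGroup) :
    ∃ a b c d : ℂ, ∃ h : a * d - b * c ≠ 0, g = mob a b c d h := by
  obtain ⟨_, M, rfl⟩ := g
  have hd := M.det_ne_zero
  rw [Matrix.det_fin_two] at hd
  refine ⟨M 0 0, M 0 1, M 1 0, M 1 1, hd, ?_⟩
  apply Subtype.ext
  change MulAction.toPermHom (GL (Fin 2) ℂ) ExtPlane M = MulAction.toPermHom (GL (Fin 2) ℂ) ExtPlane _
  congr 1
  ext i j
  fin_cases i <;> fin_cases j <;> simp [Matrix.GeneralLinearGroup.mkOfDetNeZero]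

theorem exists_affine {g : MoebiusGroup} (hg : g • (∞ : ExtPlane) = ∞) :
    ∃ a b : ℂ, a ≠ 0 ∧ ∀ z : ℂ, g • (z : ExtPlane) = ((a * z + b : ℂ) : ExtPlane) := by
  obtain ⟨a, b, c, d, h, rfl⟩ := exists_eq_mob g
  have hc : c = 0 := by
    by_contra hc
    rw [mob_smul_infty, if_neg hc] at hg
    exact OnePoint.coe_ne_infty _ hg
  subst hc
  have ha : a ≠ 0 := by rintro rfl; simp at h
  have hd : d ≠ 0 := by rintro rfl; simp at h
  refine ⟨a / d, b / d, div_ne_zero ha hd, fun z => ?_⟩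
  rw [mob_smul_coe]
  simp only [zero_mul, zero_add, hd, if_false]
  congr 1
  field_simp

theorem exists_smul_infty_smul_zero {p q : ExtPlane} (hpq : p ≠ q) :
    ∃ ψ : MoebiusGroup, ψ • (∞ : ExtPlane) = p ∧ ψ • ((0 : ℂ) : ExtPlane) = q := by
  induction p using OnePoint.rec with
  | infty =>
    induction q using OnePoint.rec with
    | infty => exact absurd rfl hpq
    | coe q => exact ⟨mob 1 q 0 1 (by simp), by simp [mob_smul_infty], by simp [mob_smul_coe]⟩
  | coe p =>
    induction q using OnePoint.rec with
    | infty => exact ⟨mob p 1 1 0 (by simp), by simp [mob_smul_infty], by simp [mob_smul_coe]⟩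
    | coe q =>
      have h : p ≠ q := by rintro rfl; exact hpq rfl
      exact ⟨mob p q 1 1 (by simpa [sub_eq_zero] using h), by simp [mob_smul_infty],
        by simp [mob_smul_coe]⟩

theorem exists_smul_infty (p : ExtPlane) : ∃ ψ : MoebiusGroup, ψ • (∞ : ExtPlane) = p := by
  obtain ⟨q, hq⟩ := exists_ne p
  obtain ⟨ψ, h, -⟩ := exists_smul_infty_smul_zero hq.symm
  exact ⟨ψ, h⟩

theorem conj_smul_eq_self {g ψ : MoebiusGroup} {p : ExtPlane} :
    (ψ⁻¹ * g * ψ) • p = p ↔ g • ψ • p = ψ • p := by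
  rw [mul_smul, mul_smul, inv_smul_eq_iff]

theorem eq_one_of_three_fixed {g : MoebiusGroup} {p q r : ExtPlane} (hpq : p ≠ q) (hpr : p ≠ r)
    (hqr : q ≠ r) (hp : g • p = p) (hq : g • q = q) (hr : g • r = r) : g = 1 := by
  obtain ⟨ψ, rfl⟩ := exists_smul_infty p
  obtain ⟨q, rfl⟩ : ∃ q', q = ψ • q' := ⟨ψ⁻¹ • q, by simp⟩
  obtain ⟨r, rfl⟩ : ∃ r', r = ψ • r' := ⟨ψ⁻¹ • r, by simp⟩
  rw [← conj_smul_eq_self] at hp hq hr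
  have key : ψ⁻¹ * g * ψ = 1 := by
    obtain ⟨a, b, ha, hab⟩ := exists_affine hp
    induction q using OnePoint.rec with
    | infty => exact absurd rfl hpq
    | coe q =>
    induction r using OnePoint.rec with
    | infty => exact absurd rfl hpr
    | coe r =>
    have hne : q ≠ r := by rintro rfl; exact hqr rfl
    rw [hab, OnePoint.coe_eq_coe] at hq hr
    have ha1 : a = 1 := by
      have : (a - 1) * (q - r) = 0 := by linear_combination hq - hr
      rcases mul_eq_zero.1 this with h | h
      · exact sub_eq_zero.1 h
      · exact absurd (sub_eq_zero.1 h) hne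
    subst ha1
    have hb : b = 0 := by linear_combination hq
    subst hb
    apply moebius_ext
    intro x
    induction x using OnePoint.rec with
    | infty => rw [hp, one_smul]
    | coe z => rw [hab, one_smul]; simp
  have : g = ψ * (ψ⁻¹ * g * ψ) * ψ⁻¹ := by group
  rw [this, key]; group

/-- With the common fixed point moved to `∞`, both maps are affine and their commutator is a
translation. A translation of finite order is trivial. -/
theorem commute_of_common_fixed {H : Subgroup MoebiusGroup} [Finite H] {g h : MoebiusGroup}
    (hgH : g ∈ H) (hhH : h ∈ H) {p : ExtPlane} (hg : g • p = p) (hh : h • p = p) :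
    g * h = h * g := by
  obtain ⟨ψ, rfl⟩ := exists_smul_infty p
  rw [← conj_smul_eq_self] at hg hh
  obtain ⟨a, b, ha, hab⟩ := exists_affine hg
  obtain ⟨c, d, hc, hcd⟩ := exists_affine hh
  obtain ⟨n, hn, hpow⟩ : ∃ n : ℕ, 0 < n ∧ (g * h * (h * g)⁻¹) ^ n = 1 := by
    have hm : g * h * (h * g)⁻¹ ∈ H :=
      H.mul_mem (H.mul_mem hgH hhH) (H.inv_mem (H.mul_mem hhH hgH))
    have := isOfFinOrder_of_finite (⟨_, hm⟩ : H)
    obtain ⟨n, hn, h⟩ := isOfFinOrder_iff_pow_eq_one.1 this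
    exact ⟨n, hn, congrArg Subtype.val h⟩
  set k := ψ⁻¹ * (g * h * (h * g)⁻¹) * ψ with hk
  set g' := ψ⁻¹ * g * ψ with hg'
  set h' := ψ⁻¹ * h * ψ with hh'
  have hkmul : k * (h' * g') = g' * h' := by rw [hk, hg', hh']; group
  have hkn : k ^ n = 1 := by
    have : k = MulAut.conj ψ⁻¹ (g * h * (h * g)⁻¹) := by simp [hk, mul_assoc]
    rw [this, ← map_pow, hpow, map_one]
  have hkz : ∀ z : ℂ, k • ((c * (a * z + b) + d : ℂ) : ExtPlane)
      = ((a * (c * z + d) + b : ℂ) : ExtPlane) := by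
    intro z
    have := congrArg (fun m : MoebiusGroup => m • (z : ExtPlane)) hkmul
    simpa only [mul_smul, hab, hcd] using this
  -- The translation length of the commutator `k`; its iterates send `0` to `m * τ`, so finite order
  -- forces `τ = 0`.
  set τ := a * d + b - (c * b + d) with hτ
  have hkt : ∀ w : ℂ, k • (w : ExtPlane) = ((w + τ : ℂ) : ExtPlane) := by
    intro w
    have := hkz (((w - d) / c - b) / a)
    have e1 : c * (a * (((w - d) / c - b) / a) + b) + d = w := by field_simp; ring
    have e2 : a * (c * (((w - d) / c - b) / a) + d) + b = w + τ := by
      rw [hτ]; field_simp; ring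
    rwa [e1, e2] at this
  have hpowt : ∀ m : ℕ, k ^ m • ((0 : ℂ) : ExtPlane) = ((m * τ : ℂ) : ExtPlane) := by
    intro m
    induction m with
    | zero => simp
    | succ m ih => rw [pow_succ', mul_smul, ih, hkt]; congr 1; push_cast; ring
  have hτ0 : τ = 0 := by
    have := hpowt n
    rw [hkn, one_smul, OnePoint.coe_eq_coe] at this
    have hn0 : (n : ℂ) ≠ 0 := by exact_mod_cast hn.ne'
    exact (mul_eq_zero.1 this.symm).resolve_left hn0
  have hcomm : g' * h' = h' * g' := by
    apply moebius_ext
    intro x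
    induction x using OnePoint.rec with
    | infty => simp only [mul_smul, hg, hh]
    | coe z =>
      simp only [mul_smul, hab, hcd]
      congr 1
      linear_combination hτ0
  have e1 : g * h = ψ * (g' * h') * ψ⁻¹ := by rw [hg', hh']; group
  have e2 : h * g = ψ * (h' * g') * ψ⁻¹ := by rw [hg', hh']; group
  rw [e1, e2, hcomm]

theorem exists_fixed_point (g : MoebiusGroup) : ∃ p : ExtPlane, g • p = p := by
  obtain ⟨a, b, c, d, h, rfl⟩ := exists_eq_mob g
  by_cases hc : c = 0
  · exact ⟨∞, by rw [mob_smul_infty, if_pos hc]⟩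
  obtain ⟨s, hs⟩ := IsSquare.exists_sq (discrim c (d - a) (-b))
    (IsAlgClosed.exists_pow_nat_eq (discrim c (d - a) (-b)) (n := 2) (by norm_num) |>.imp
      fun s hs => by rw [← hs, sq])
  have := (quadratic_eq_zero_iff hc (by rw [hs, sq]) ((-(d - a) + s) / (2 * c))).2 (Or.inl rfl)
  set z := (-(d - a) + s) / (2 * c)
  -- A root of the fixed-point equation at which the denominator vanishes would also annihilate the
  -- numerator, contradicting the nonzero determinant.
  have hz : c * z + d ≠ 0 := by
    intro h0
    apply h
    have : a * z + b = 0 := by linear_combination z * h0 - this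
    linear_combination a * h0 - c * this
  refine ⟨z, ?_⟩
  rw [mob_smul_coe, if_neg hz]
  congr 1
  rw [div_eq_iff hz]
  linear_combination -this

/-! ### Stabilizers of finite sets -/

theorem smul_eq_of_mem_stab {α : Set ExtPlane} {g : MoebiusGroup} (hg : g ∈ stab α) : g • α = α :=
  hg

theorem smul_mem_of_mem_stab {α : Set ExtPlane} {g : MoebiusGroup} (hg : g ∈ stab α) {x : ExtPlane}
    (hx : x ∈ α) : g • x ∈ α := by
  rw [← smul_eq_of_mem_stab hg]
  exact Set.smul_mem_smul_set hx

theorem mem_stab_of_forall {α : Set ExtPlane} (hα : α.Finite) {g : MoebiusGroup}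
    (hg : ∀ x ∈ α, g • x ∈ α) : g ∈ stab α := by
  change g • α = α
  have hsub : g • α ⊆ α := by
    rintro _ ⟨x, hx, rfl⟩
    exact hg x hx
  exact Set.eq_of_subset_of_ncard_le hsub (by rw [Set.ncard_smul_set]) hα

/-- A transformation is determined by its values at three points, so the stabilizer embeds in the
finite set of self-maps of `α`. -/
theorem finite_stab {α : Set ExtPlane} (hα : α.Finite) (h3 : 2 < α.ncard) : Finite (stab α) := by
  have : Finite α := hα
  obtain ⟨x, y, z, hx, hy, hz, hxy, hxz, hyz⟩ := (Set.two_lt_ncard_iff hα).1 h3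
  let F : stab α → (α → α) := fun g x => ⟨(g : MoebiusGroup) • (x : ExtPlane),
    smul_mem_of_mem_stab g.2 x.2⟩
  refine Finite.of_injective F fun g h hgh => ?_
  have key : ∀ x ∈ α, (h : MoebiusGroup)⁻¹ • (g : MoebiusGroup) • x = x := by
    intro x hx
    have := congrArg Subtype.val (congrFun hgh ⟨x, hx⟩)
    rw [inv_smul_eq_iff]
    exact this
  have := eq_one_of_three_fixed (g := (h : MoebiusGroup)⁻¹ * g) hxy hxz hyz
    (by rw [mul_smul]; exact key x hx) (by rw [mul_smul]; exact key y hy)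
    (by rw [mul_smul]; exact key z hz)
  exact Subtype.ext (inv_mul_eq_one.1 this).symm

/-! ### Tetrahedral configurations -/

/-- `g` permutes the points `v i`, `f i` and `e i j` by permuting their indices by `σ`. -/
def ActsBy (v f : Fin 4 → ExtPlane) (e : Fin 4 → Fin 4 → ExtPlane) (g : MoebiusGroup)
    (σ : Equiv.Perm (Fin 4)) : Prop :=
  (∀ i, g • v i = v (σ i)) ∧ (∀ i, g • f i = f (σ i)) ∧ ∀ i j, g • e i j = e (σ i) (σ j)

/-- `G` acts on the vertices `v i`, the face points `f i` and the edge points `e i j` as the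
alternating group acts on the indices. -/
structure IsTetrahedralConfig (G : Subgroup MoebiusGroup) (v f : Fin 4 → ExtPlane)
    (e : Fin 4 → Fin 4 → ExtPlane) : Prop where
  v_inj : Function.Injective v
  f_inj : Function.Injective f
  v_ne_f : ∀ i j, v i ≠ f j
  e_comm : ∀ i j, e i j = e j i
  e_inj : ∀ i j k l, i ≠ j → k ≠ l → e i j = e k l → (i = k ∧ j = l) ∨ (i = l ∧ j = k)
  v_ne_e : ∀ i j k, j ≠ k → v i ≠ e j k
  f_ne_e : ∀ i j k, j ≠ k → f i ≠ e j k
  exists_perm : ∀ g ∈ G, ∃ σ ∈ alternatingGroup (Fin 4), ActsBy v f e g σ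
  exists_mem : ∀ σ ∈ alternatingGroup (Fin 4), ∃ g ∈ G, ActsBy v f e g σ

theorem eq_of_smul_eq_on {v : Fin 4 → ExtPlane} (hv : Function.Injective v) {g h : MoebiusGroup}
    (H : ∀ i, g • v i = h • v i) : g = h := by
  have key : ∀ i, (h⁻¹ * g) • v i = v i := fun i => by rw [mul_smul, H, inv_smul_smul]
  have := eq_one_of_three_fixed (g := h⁻¹ * g) (hv.ne (show (0 : Fin 4) ≠ 1 by decide))
    (hv.ne (show (0 : Fin 4) ≠ 2 by decide)) (hv.ne (show (1 : Fin 4) ≠ 2 by decide))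
    (key 0) (key 1) (key 2)
  exact (inv_mul_eq_one.1 this).symm

theorem exists_permHom {G : Subgroup MoebiusGroup} {v f : Fin 4 → ExtPlane}
    {e : Fin 4 → Fin 4 → ExtPlane} (hv : Function.Injective v)
    (H : ∀ g ∈ G, ∃ σ, ActsBy v f e g σ) :
    ∃ ρ : G →* Equiv.Perm (Fin 4), Function.Injective ρ ∧
      ∀ g : G, ActsBy v f e (g : MoebiusGroup) (ρ g) := by
  choose ρ hρ using fun g : G => H g.1 g.2
  refine ⟨MonoidHom.mk' ρ fun g h => ?_, fun g h hgh => ?_, hρ⟩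
  · ext1 i
    apply hv
    rw [← (hρ (g * h)).1, Equiv.Perm.mul_apply, ← (hρ g).1, ← (hρ h).1, ← mul_smul]
    rfl
  · apply Subtype.ext
    apply eq_of_smul_eq_on hv
    intro i
    rw [(hρ g).1, (hρ h).1]
    exact congrArg (fun s : Equiv.Perm (Fin 4) => v (s i)) hgh

/-- The action on the four vertices is faithful, so its image in S₄ has order 12, hence index 2; the
only such subgroup is A₄. -/
theorem exists_bijection_alternatingGroup {G : Subgroup MoebiusGroup} {v f : Fin 4 → ExtPlane}
    {e : Fin 4 → Fin 4 → ExtPlane} (hG : Nonempty (G ≃* alternatingGroup (Fin 4)))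
    (hv : Function.Injective v) (H : ∀ g ∈ G, ∃ σ, ActsBy v f e g σ) :
    (∀ g ∈ G, ∃ σ ∈ alternatingGroup (Fin 4), ActsBy v f e g σ) ∧
      ∀ σ ∈ alternatingGroup (Fin 4), ∃ g ∈ G, ActsBy v f e g σ := by
  obtain ⟨ρ, hρ, hact⟩ := exists_permHom hv H
  obtain ⟨i⟩ := hG
  have hcard : Nat.card ρ.range = Nat.card (alternatingGroup (Fin 4)) := by
    rw [← Nat.card_congr i.toEquiv, ← Nat.card_congr (MonoidHom.ofInjective hρ).toEquiv]
  have hA : ρ.range = alternatingGroup (Fin 4) := by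
    apply Equiv.Perm.eq_alternatingGroup_of_index_eq_two
    have h1 := ρ.range.index_mul_card
    have h2 := (alternatingGroup (Fin 4)).index_mul_card
    rw [alternatingGroup.index_eq_two, ← hcard] at h2
    rw [← h2] at h1
    exact Nat.eq_of_mul_eq_mul_right Nat.card_pos h1
  constructor
  · intro g hg
    exact ⟨ρ ⟨g, hg⟩, hA ▸ MonoidHom.mem_range.2 ⟨⟨g, hg⟩, rfl⟩, hact ⟨g, hg⟩⟩
  · intro σ hσ
    rw [← hA] at hσ
    obtain ⟨g, rfl⟩ := hσ
    exact ⟨g, g.2, hact g⟩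

/-! ### Stereographic projection and the geometry of an inscribed regular tetrahedron -/

theorem norm_sq_space (x : Space) : ‖x‖ ^ 2 = x 0 ^ 2 + x 1 ^ 2 + x 2 ^ 2 := by
  rw [EuclideanSpace.norm_sq_eq, Fin.sum_univ_three]
  simp

theorem stereo_injOn {x y : Space} (hx : ‖x‖ = 1) (hy : ‖y‖ = 1) (h : stereo x = stereo y) :
    x = y := by
  have hx' := norm_sq_space x
  have hy' := norm_sq_space y
  rw [hx] at hx'
  rw [hy] at hy'
  suffices x 0 = y 0 ∧ x 1 = y 1 ∧ x 2 = y 2 by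
    ext i
    fin_cases i
    exacts [this.1, this.2.1, this.2.2]
  unfold stereo at h
  split_ifs at h with h1 h2 h2
  · rw [h1] at hx'
    rw [h2] at hy'
    have e1 : x 0 = 0 := by nlinarith [sq_nonneg (x 0), sq_nonneg (x 1)]
    have e2 : x 1 = 0 := by nlinarith [sq_nonneg (x 0), sq_nonneg (x 1)]
    have e3 : y 0 = 0 := by nlinarith [sq_nonneg (y 0), sq_nonneg (y 1)]
    have e4 : y 1 = 0 := by nlinarith [sq_nonneg (y 0), sq_nonneg (y 1)]
    exact ⟨by rw [e1, e3], by rw [e2, e4], by rw [h1, h2]⟩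
  · exact absurd h.symm (OnePoint.coe_ne_infty _)
  · exact absurd h (OnePoint.coe_ne_infty _)
  · rw [OnePoint.coe_eq_coe, Complex.mk.injEq] at h
    obtain ⟨h3, h4⟩ := h
    have hxn : 1 - x 2 ≠ 0 := fun h => h1 (by linarith)
    have hyn : 1 - y 2 ≠ 0 := fun h => h2 (by linarith)
    -- For the projected point `z`, `|z|² + 1 = 2 / (1 - x 2)`, so `z` determines the height `x 2`
    -- and then the other coordinates.
    have ex : (x 0 / (1 - x 2)) ^ 2 + (x 1 / (1 - x 2)) ^ 2 + 1 = 2 / (1 - x 2) := by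
      field_simp
      linear_combination -hx'
    have ey : (y 0 / (1 - y 2)) ^ 2 + (y 1 / (1 - y 2)) ^ 2 + 1 = 2 / (1 - y 2) := by
      field_simp
      linear_combination -hy'
    rw [h3, h4, ey, div_eq_div_iff hyn hxn] at ex
    have h5 : x 2 = y 2 := by linarith
    rw [h5, div_left_inj' hyn] at h3 h4
    exact ⟨h3, h4, h5⟩

section Tetrahedron

variable {T : Affine.Simplex ℝ Space 3}

theorem IsInscribedRegular.exists_inner_eq (hT : IsInscribedRegular T) :
    ∃ c : ℝ, ∀ i j, i ≠ j → inner ℝ (T.points i) (T.points j) = c := by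
  obtain ⟨hn, d, hd⟩ := hT
  refine ⟨1 - d ^ 2 / 2, fun i j hij => ?_⟩
  have h := norm_sub_sq_real (T.points i) (T.points j)
  rw [← dist_eq_norm, hd i j hij, hn, hn] at h
  linarith

theorem IsInscribedRegular.inner_self (hT : IsInscribedRegular T) (i : Fin 4) :
    inner ℝ (T.points i) (T.points i) = 1 := by
  rw [real_inner_self_eq_norm_sq, hT.1, one_pow]

/-- Four vectors in ℝ³ satisfy a linear relation. Pairing it with each vertex, where all mixed inner
products equal the same `c ≠ 1`, shows that its coefficients are all equal. -/
theorem IsInscribedRegular.sum_points (hT : IsInscribedRegular T) : ∑ i, T.points i = 0 := by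
  obtain ⟨c, hc⟩ := hT.exists_inner_eq
  have hdep : ¬ LinearIndependent ℝ T.points := by
    intro h
    have := h.fintype_card_le_finrank
    simp at this
  rw [Fintype.not_linearIndependent_iff] at hdep
  obtain ⟨w, hw, k, hk⟩ := hdep
  have hc1 : c ≠ 1 := by
    intro h1
    have := norm_sub_sq_real (T.points 0) (T.points 1)
    rw [hc 0 1 (by decide), hT.1, hT.1, h1] at this
    have h2 : T.points 0 - T.points 1 = 0 := by
      rw [← norm_eq_zero, ← sq_eq_zero_iff, this]; norm_num
    have := T.independent.injective (sub_eq_zero.1 h2)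
    exact absurd this (by decide)
  have hj : ∀ j, w j * (1 - c) = - c * ∑ i, w i := by
    intro j
    have h0 : inner ℝ (∑ i, w i • T.points i) (T.points j) = 0 := by rw [hw, inner_zero_left]
    rw [sum_inner] at h0
    simp only [real_inner_smul_left] at h0
    have h1 : ∀ i, w i * inner ℝ (T.points i) (T.points j)
        = w i * c + if i = j then w j * (1 - c) else 0 := by
      intro i
      split_ifs with h
      · subst h; rw [hT.inner_self]; ring
      · rw [hc i j h]; ring
    simp only [h1, Finset.sum_add_distrib, Finset.sum_ite_eq', Finset.mem_univ, if_true,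
      ← Finset.sum_mul] at h0
    linarith
  have hwk : ∀ j, w j = w k := fun j =>
    mul_right_cancel₀ (sub_ne_zero.2 (Ne.symm hc1)) ((hj j).trans (hj k).symm)
  simp only [hwk, ← Finset.smul_sum] at hw
  exact (smul_eq_zero.1 hw).resolve_left hk

theorem IsInscribedRegular.inner_of_ne (hT : IsInscribedRegular T) {i j : Fin 4} (hij : i ≠ j) :
    inner ℝ (T.points i) (T.points j) = -1 / 3 := by
  obtain ⟨c, hc⟩ := hT.exists_inner_eq
  have h0 : inner ℝ (∑ i, T.points i) (T.points 0) = 0 := by rw [hT.sum_points, inner_zero_left]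
  rw [sum_inner, Fin.sum_univ_four, hT.inner_self, hc 1 0 (by decide), hc 2 0 (by decide),
    hc 3 0 (by decide)] at h0
  rw [hc i j hij]
  linarith

theorem IsInscribedRegular.inner_eq_ite (hT : IsInscribedRegular T) (i j : Fin 4) :
    inner ℝ (T.points i) (T.points j) = if i = j then 1 else -1 / 3 := by
  split_ifs with h
  · rw [h, hT.inner_self]
  · exact hT.inner_of_ne h

theorem IsInscribedRegular.centralProj_face (hT : IsInscribedRegular T) (i : Fin 4) :
    centralProj (T.faceOppositeCentroid i) = -T.points i := by
  have h : T.faceOppositeCentroid i = (1 / 3 : ℝ) • (-T.points i) := by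
    have hs' : ∑ j, (T.points j -ᵥ T.points i) = (4 : ℝ) • -T.points i := by
      simp only [vsub_eq_sub, Finset.sum_sub_distrib, hT.sum_points, Finset.sum_const,
        Finset.card_univ, Fintype.card_fin]
      module
    rw [T.faceOppositeCentroid_eq_sum_vsub_vadd i, hs']
    simp only [vadd_eq_add]
    push_cast
    module
  rw [h, centralProj, norm_smul, norm_neg, hT.1, smul_smul]
  norm_num

/-- The projection to the sphere of the midpoint of an edge. -/
noncomputable def edgePoint (T : Affine.Simplex ℝ Space 3) (i j : Fin 4) : Space :=
  centralProj (midpoint ℝ (T.points i) (T.points j))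

theorem IsInscribedRegular.edgePoint_eq (hT : IsInscribedRegular T) {i j : Fin 4} (hij : i ≠ j) :
    edgePoint T i j = (√3 / 2) • (T.points i + T.points j) := by
  have h1 : ‖T.points i + T.points j‖ = 2 / √3 := by
    have := norm_add_sq_real (T.points i) (T.points j)
    rw [hT.1, hT.1, hT.inner_of_ne hij] at this
    rw [← abs_norm, ← abs_of_pos (show 0 < 2 / √3 by positivity), ← sq_eq_sq_iff_abs_eq_abs, this,
      div_pow, Real.sq_sqrt (by norm_num)]
    norm_num
  rw [edgePoint, centralProj, midpoint_eq_smul_add, norm_smul, h1, smul_smul]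
  congr 1
  simp [div_eq_mul_inv]

theorem IsInscribedRegular.norm_edgePoint (hT : IsInscribedRegular T) {i j : Fin 4} (hij : i ≠ j) :
    ‖edgePoint T i j‖ = 1 := by
  rw [← pow_eq_one_iff_of_nonneg (norm_nonneg _) two_ne_zero, ← real_inner_self_eq_norm_sq, hT.edgePoint_eq hij,
    real_inner_smul_left, real_inner_smul_right, inner_add_left, inner_add_right, inner_add_right,
    hT.inner_self, hT.inner_self, hT.inner_of_ne hij, hT.inner_of_ne hij.symm]
  have := Real.sq_sqrt (show (0 : ℝ) ≤ 3 by norm_num)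
  linear_combination (1 / 3) * this

theorem IsInscribedRegular.inner_edgePoint (hT : IsInscribedRegular T) {i j : Fin 4} (hij : i ≠ j)
    (p : Fin 4) : inner ℝ (edgePoint T i j) (T.points p)
      = if p = i ∨ p = j then √3 / 3 else -(√3 / 3) := by
  rw [hT.edgePoint_eq hij, real_inner_smul_left, inner_add_left, hT.inner_eq_ite, hT.inner_eq_ite]
  by_cases h1 : i = p
  · have h2 : j ≠ p := fun h => hij (h1.trans h.symm)
    rw [if_pos h1, if_neg h2, if_pos (Or.inl h1.symm)]; ring
  · by_cases h2 : j = p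
    · rw [if_neg h1, if_pos h2, if_pos (Or.inr h2.symm)]; ring
    · rw [if_neg h1, if_neg h2, if_neg (by tauto)]; ring

theorem edgePoint_comm (i j : Fin 4) : edgePoint T i j = edgePoint T j i := by
  rw [edgePoint, edgePoint, midpoint_comm]

theorem IsInscribedRegular.edgePoint_inj (hT : IsInscribedRegular T) {i j k l : Fin 4}
    (hij : i ≠ j) (hkl : k ≠ l) (h : edgePoint T i j = edgePoint T k l) :
    (i = k ∧ j = l) ∨ (i = l ∧ j = k) := by
  have h3 : (0 : ℝ) < √3 := by positivity
  have key : ∀ p, (p = i ∨ p = j) → (p = k ∨ p = l) := by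
    intro p hp
    by_contra hq
    have h1 := hT.inner_edgePoint hij p
    rw [h, hT.inner_edgePoint hkl, if_pos hp, if_neg hq] at h1
    linarith
  have hi := key i (Or.inl rfl)
  have hj := key j (Or.inr rfl)
  grind

/-- Separates edge points from `± T.points i`: the latter has the same inner product with each of
the three other vertices, an edge point does not. -/
theorem IsInscribedRegular.exists_ne_inner_edgePoint (hT : IsInscribedRegular T) {j k : Fin 4}
    (hjk : j ≠ k) (i : Fin 4) :
    ∃ p q, p ≠ i ∧ q ≠ i ∧ inner ℝ (edgePoint T j k) (T.points p) ≠
      inner ℝ (edgePoint T j k) (T.points q) := by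
  have h3 : (0 : ℝ) < √3 := by positivity
  obtain ⟨p, q, hp, hq, h1, h2⟩ : ∃ p q, p ≠ i ∧ q ≠ i ∧ (p = j ∨ p = k) ∧ ¬ (q = j ∨ q = k) := by
    revert hjk; revert i j k; decide
  refine ⟨p, q, hp, hq, ?_⟩
  rw [hT.inner_edgePoint hjk, hT.inner_edgePoint hjk, if_pos h1, if_neg h2]
  intro h
  linarith

theorem IsInscribedRegular.point_ne_edgePoint (hT : IsInscribedRegular T) {j k : Fin 4}
    (hjk : j ≠ k) (i : Fin 4) : T.points i ≠ edgePoint T j k := by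
  intro h
  obtain ⟨p, q, hp, hq, hne⟩ := hT.exists_ne_inner_edgePoint hjk i
  rw [← h, hT.inner_of_ne hp.symm, hT.inner_of_ne hq.symm] at hne
  exact hne rfl

theorem IsInscribedRegular.neg_point_ne_edgePoint (hT : IsInscribedRegular T) {j k : Fin 4}
    (hjk : j ≠ k) (i : Fin 4) : -T.points i ≠ edgePoint T j k := by
  intro h
  obtain ⟨p, q, hp, hq, hne⟩ := hT.exists_ne_inner_edgePoint hjk i
  rw [← h, inner_neg_left, inner_neg_left, hT.inner_of_ne hp.symm, hT.inner_of_ne hq.symm] at hne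
  exact hne rfl

theorem IsInscribedRegular.point_ne_neg_point (hT : IsInscribedRegular T) (i j : Fin 4) :
    T.points i ≠ -T.points j := by
  intro h
  have := hT.inner_eq_ite i j
  rw [h, inner_neg_left, hT.inner_self] at this
  split_ifs at this <;> norm_num at this

/-- The images of the vertices of `T` under `φ`. -/
noncomputable def tetraV (φ : MoebiusGroup) (T : Affine.Simplex ℝ Space 3) (i : Fin 4) : ExtPlane :=
  φ • stereo (T.points i)

/-- The images of the face points of `T` under `φ`. -/
noncomputable def tetraF (φ : MoebiusGroup) (T : Affine.Simplex ℝ Space 3) (i : Fin 4) : ExtPlane :=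
  φ • stereo (-T.points i)

/-- The images of the edge points of `T` under `φ`. -/
noncomputable def tetraE (φ : MoebiusGroup) (T : Affine.Simplex ℝ Space 3) (i j : Fin 4) :
    ExtPlane :=
  φ • stereo (edgePoint T i j)

theorem ActsAsRotationOf.exists_actsBy (hT : IsInscribedRegular T) {g φ : MoebiusGroup}
    (hg : ActsAsRotationOf T (φ⁻¹ * g * φ)) :
    ∃ σ, ActsBy (tetraV φ T) (tetraF φ T) (tetraE φ T) g σ := by
  obtain ⟨A, -, hA, hst⟩ := hg
  have h1 : ∀ i, ∃ j, T.points j = Matrix.toEuclideanLin A (T.points i) := fun i => by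
    have : Matrix.toEuclideanLin A (T.points i) ∈ vertexSet T := hA ▸ ⟨_, ⟨i, rfl⟩, rfl⟩
    exact this
  choose σ hσ using h1
  have hsurj : Function.Surjective σ := by
    intro j
    have : T.points j ∈ Matrix.toEuclideanLin A '' vertexSet T := by
      rw [hA]; exact ⟨j, rfl⟩
    obtain ⟨_, ⟨i, rfl⟩, hi⟩ := this
    exact ⟨i, T.independent.injective ((hσ i).trans hi)⟩
  have hinj : Function.Injective σ := Finite.injective_iff_surjective.2 hsurj
  have hst' : ∀ x : Space, ‖x‖ = 1 → g • φ • stereo x = φ • stereo (Matrix.toEuclideanLin A x) := by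
    intro x hx
    rw [← hst x hx, mul_smul, mul_smul, smul_inv_smul]
  obtain ⟨τ, hτ⟩ : ∃ τ : Equiv.Perm (Fin 4), ∀ i, τ i = σ i :=
    ⟨Equiv.ofBijective σ ⟨hinj, hsurj⟩, fun _ => rfl⟩
  refine ⟨τ, fun i => ?_, fun i => ?_, fun i j => ?_⟩
  · simp only [tetraV, hτ, hσ]
    exact hst' _ (hT.1 i)
  · simp only [tetraF, hτ, hσ]
    rw [hst' _ (by rw [norm_neg]; exact hT.1 i), map_neg]
  · simp only [tetraE, hτ]
    -- `ActsBy` also quantifies over the diagonal, where `edgePoint T i i` is just the vertex.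
    by_cases hij : i = j
    · subst hij
      have : ∀ i, edgePoint T i i = T.points i := fun i => by
        rw [edgePoint, midpoint_self, centralProj, hT.1, inv_one, one_smul]
      rw [this, this, hσ, hst' _ (hT.1 i)]
    · rw [hst' _ (hT.norm_edgePoint hij), hT.edgePoint_eq hij, hT.edgePoint_eq (hinj.ne hij), hσ, hσ,
        _root_.map_smul, map_add]

theorem tetraV_injective (hT : IsInscribedRegular T) (φ : MoebiusGroup) :
    Function.Injective (tetraV φ T) := fun i j h =>
  T.independent.injective (stereo_injOn (hT.1 i) (hT.1 j) (smul_left_cancel φ h))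

theorem isTetrahedralConfig_of_acts {G : Subgroup MoebiusGroup}
    (hG : Nonempty (G ≃* alternatingGroup (Fin 4))) {φ : MoebiusGroup} (hT : IsInscribedRegular T)
    (hg : ∀ g ∈ G, ActsAsRotationOf T (φ⁻¹ * g * φ)) :
    IsTetrahedralConfig G (tetraV φ T) (tetraF φ T) (tetraE φ T) := by
  have hn : ∀ i, ‖-T.points i‖ = 1 := fun i => by rw [norm_neg]; exact hT.1 i
  have hv := tetraV_injective hT φ
  obtain ⟨h1, h2⟩ := exists_bijection_alternatingGroup hG hv
    fun g h => (hg g h).exists_actsBy hT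
  refine ⟨hv, fun i j h => ?_, fun i j h => ?_, fun i j => ?_, fun i j k l hij hkl h => ?_,
    fun i j k hjk h => ?_, fun i j k hjk h => ?_, h1, h2⟩
  · exact T.independent.injective
      (neg_injective (stereo_injOn (hn i) (hn j) (smul_left_cancel φ h)))
  · exact hT.point_ne_neg_point i j (stereo_injOn (hT.1 i) (hn j) (smul_left_cancel φ h))
  · rw [tetraE, edgePoint_comm, tetraE]
  · exact hT.edgePoint_inj hij hkl
      (stereo_injOn (hT.norm_edgePoint hij) (hT.norm_edgePoint hkl) (smul_left_cancel φ h))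
  · exact hT.point_ne_edgePoint hjk i
      (stereo_injOn (hT.1 i) (hT.norm_edgePoint hjk) (smul_left_cancel φ h))
  · exact hT.neg_point_ne_edgePoint hjk i
      (stereo_injOn (hn i) (hT.norm_edgePoint hjk) (smul_left_cancel φ h))

theorem smul_stereo_vertexSet (φ : MoebiusGroup) :
    φ • (stereo '' vertexSet T) = Set.range (tetraV φ T) := by
  rw [vertexSet, ← Set.range_comp, Set.smul_set_range]
  rfl

theorem smul_stereo_faceSet (hT : IsInscribedRegular T) (φ : MoebiusGroup) :
    φ • (stereo '' faceSet T) = Set.range (tetraF φ T) := by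
  have : faceSet T = Set.range fun i => -T.points i := by
    ext x
    simp only [faceSet, hT.centralProj_face, Set.mem_ofPred_eq, Set.mem_range, eq_comm]
  rw [this, ← Set.range_comp, Set.smul_set_range]
  rfl

theorem smul_stereo_edgeSet (φ : MoebiusGroup) :
    φ • (stereo '' edgeSet T) = {x | ∃ i j, i ≠ j ∧ tetraE φ T i j = x} := by
  ext x
  constructor
  · rintro ⟨_, ⟨_, ⟨i, j, hij, rfl⟩, rfl⟩, rfl⟩
    exact ⟨i, j, hij, rfl⟩
  · rintro ⟨i, j, hij, rfl⟩
    exact ⟨_, ⟨_, ⟨i, j, hij, rfl⟩, rfl⟩, rfl⟩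

end Tetrahedron

theorem IsTetrahedralTriple.exists_config {G : Subgroup MoebiusGroup}
    (hG : Nonempty (G ≃* alternatingGroup (Fin 4))) {V F E : Set ExtPlane}
    (h : IsTetrahedralTriple G V F E) :
    ∃ v f e, IsTetrahedralConfig G v f e ∧ V = Set.range v ∧ F = Set.range f ∧
      E = {x | ∃ i j, i ≠ j ∧ e i j = x} := by
  obtain ⟨φ, T, hT, hg, rfl, rfl, rfl⟩ := h
  exact ⟨_, _, _, isTetrahedralConfig_of_acts hG hT hg, smul_stereo_vertexSet φ,
    smul_stereo_faceSet hT φ, smul_stereo_edgeSet φ⟩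

/-! ### Fixed points, orbits and special stabilizers of a configuration -/

theorem eq_or_eq_of_fixed {g : MoebiusGroup} (hg : g ≠ 1) {p q x : ExtPlane} (hpq : p ≠ q)
    (hp : g • p = p) (hq : g • q = q) (hx : g • x = x) : x = p ∨ x = q := by
  by_contra! h
  exact hg (eq_one_of_three_fixed hpq h.1.symm h.2.symm hp hq hx)

theorem exists_even_map (i j : Fin 4) : ∃ σ ∈ alternatingGroup (Fin 4), σ i = j := by
  simp only [Equiv.Perm.mem_alternatingGroup]
  revert i j
  decide

theorem exists_even_map_pair {i j k l : Fin 4} (hij : i ≠ j) (hkl : k ≠ l) :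
    ∃ σ ∈ alternatingGroup (Fin 4), σ i = k ∧ σ j = l := by
  simp only [Equiv.Perm.mem_alternatingGroup]
  revert hij hkl
  revert i j k l
  decide

/-- The cycle types in A₄ are the identity, 3-cycles and double transpositions. Each alternative
supplies two fixed points of the corresponding transformation. -/
theorem even_fixed_or_swap {σ : Equiv.Perm (Fin 4)} (hσ : σ ∈ alternatingGroup (Fin 4)) :
    (∃ i, σ i = i) ∨ ∃ i j k l, i ≠ j ∧ k ≠ l ∧ k ≠ i ∧ k ≠ j ∧ σ i = j ∧ σ j = i ∧ σ k = l ∧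
      σ l = k := by
  rw [Equiv.Perm.mem_alternatingGroup] at hσ
  revert hσ
  revert σ
  decide

/-- A 3-cycle preserves no unordered pair, so the rotation about the vertex `v i` fixes no edge
point. -/
theorem exists_even_three_cycle (i : Fin 4) : ∃ σ ∈ alternatingGroup (Fin 4), σ i = i ∧
    ∀ j k, j ≠ k → ¬ ((σ j = j ∧ σ k = k) ∨ (σ j = k ∧ σ k = j)) := by
  simp only [Equiv.Perm.mem_alternatingGroup]
  revert i
  decide

theorem exists_even_double_swap {i j : Fin 4} (hij : i ≠ j) :
    ∃ σ ∈ alternatingGroup (Fin 4), ∃ k l, k ≠ l ∧ k ≠ i ∧ k ≠ j ∧ σ i = j ∧ σ j = i ∧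
      σ k = l ∧ σ l = k := by
  simp only [Equiv.Perm.mem_alternatingGroup]
  revert hij
  revert i j
  decide

theorem exists_ne_of_ne (i : Fin 4) : ∃ j, i ≠ j := by
  revert i
  decide

namespace IsTetrahedralConfig

variable {G : Subgroup MoebiusGroup} {v f : Fin 4 → ExtPlane} {e : Fin 4 → Fin 4 → ExtPlane}

theorem orbit_v (C : IsTetrahedralConfig G v f e) (i : Fin 4) :
    MulAction.orbit G (v i) = Set.range v := by
  ext x
  constructor
  · rintro ⟨g, rfl⟩
    obtain ⟨σ, -, h⟩ := C.exists_perm g g.2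
    exact ⟨σ i, (h.1 i).symm⟩
  · rintro ⟨j, rfl⟩
    obtain ⟨σ, hσ, rfl⟩ := exists_even_map i j
    obtain ⟨g, hg, h⟩ := C.exists_mem σ hσ
    exact ⟨⟨g, hg⟩, h.1 i⟩

theorem orbit_f (C : IsTetrahedralConfig G v f e) (i : Fin 4) :
    MulAction.orbit G (f i) = Set.range f := by
  ext x
  constructor
  · rintro ⟨g, rfl⟩
    obtain ⟨σ, -, h⟩ := C.exists_perm g g.2
    exact ⟨σ i, (h.2.1 i).symm⟩
  · rintro ⟨j, rfl⟩
    obtain ⟨σ, hσ, rfl⟩ := exists_even_map i j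
    obtain ⟨g, hg, h⟩ := C.exists_mem σ hσ
    exact ⟨⟨g, hg⟩, h.2.1 i⟩

theorem orbit_e (C : IsTetrahedralConfig G v f e) {i j : Fin 4} (hij : i ≠ j) :
    MulAction.orbit G (e i j) = {x | ∃ i j, i ≠ j ∧ e i j = x} := by
  ext x
  constructor
  · rintro ⟨g, rfl⟩
    obtain ⟨σ, -, h⟩ := C.exists_perm g g.2
    exact ⟨σ i, σ j, σ.injective.ne hij, (h.2.2 i j).symm⟩
  · rintro ⟨k, l, hkl, rfl⟩
    obtain ⟨σ, hσ, rfl, rfl⟩ := exists_even_map_pair hij hkl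
    obtain ⟨g, hg, h⟩ := C.exists_mem σ hσ
    exact ⟨⟨g, hg⟩, h.2.2 i j⟩

theorem ncard_v (C : IsTetrahedralConfig G v f e) : (Set.range v).ncard = 4 := by
  rw [Set.ncard_range_of_injective C.v_inj, Nat.card_fin]

theorem ncard_f (C : IsTetrahedralConfig G v f e) : (Set.range f).ncard = 4 := by
  rw [Set.ncard_range_of_injective C.f_inj, Nat.card_fin]

theorem ncard_e (C : IsTetrahedralConfig G v f e) : {x | ∃ i j, i ≠ j ∧ e i j = x}.ncard = 6 := by
  have h : {x | ∃ i j, i ≠ j ∧ e i j = x} = (fun p : Fin 4 × Fin 4 => e p.1 p.2) ''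
      ((Finset.univ.filter fun p : Fin 4 × Fin 4 => p.1 < p.2 : Finset _) : Set _) := by
    ext x
    constructor
    · rintro ⟨i, j, hij, rfl⟩
      rcases lt_or_gt_of_ne hij with h | h
      · exact ⟨(i, j), by simpa using h, rfl⟩
      · exact ⟨(j, i), by simpa using h, C.e_comm j i⟩
    · rintro ⟨p, hp, rfl⟩
      exact ⟨p.1, p.2, ne_of_lt (by simpa using hp), rfl⟩
  rw [h, Set.InjOn.ncard_image, Set.ncard_coe_finset]
  · decide
  · rintro ⟨i, j⟩ hp ⟨k, l⟩ hq heq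
    simp only [Finset.coe_filter, Finset.mem_univ, true_and, Set.mem_ofPred_eq] at hp hq
    rcases C.e_inj i j k l hp.ne hq.ne heq with ⟨rfl, rfl⟩ | ⟨rfl, rfl⟩
    · rfl
    · exact absurd hp hq.asymm

theorem range_v_ne_range_f (C : IsTetrahedralConfig G v f e) : Set.range v ≠ Set.range f := by
  intro h
  obtain ⟨j, hj⟩ : v 0 ∈ Set.range f := h ▸ ⟨0, rfl⟩
  exact C.v_ne_f 0 j hj.symm

/-- The permutation of `g` exhibits two distinct special fixed points, either `v i` and `f i` or two
opposite edge points, and a nontrivial `g` has no third one. -/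
theorem mem_of_fixed (C : IsTetrahedralConfig G v f e) {g : MoebiusGroup} (hg : g ∈ G)
    (hg1 : g ≠ 1) {x : ExtPlane} (hx : g • x = x) :
    x ∈ Set.range v ∪ Set.range f ∪ {x | ∃ i j, i ≠ j ∧ e i j = x} := by
  obtain ⟨σ, hσ, h1, h2, h3⟩ := C.exists_perm g hg
  rcases even_fixed_or_swap hσ with ⟨i, hi⟩ | ⟨i, j, k, l, hij, hkl, hki, hkj, h⟩
  · rcases eq_or_eq_of_fixed hg1 (C.v_ne_f i i) (by rw [h1, hi]) (by rw [h2, hi]) hx with rfl | rfl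
    · exact Or.inl (Or.inl ⟨i, rfl⟩)
    · exact Or.inl (Or.inr ⟨i, rfl⟩)
  · have hne : e i j ≠ e k l := fun heq => by
      rcases C.e_inj i j k l hij hkl heq with ⟨rfl, -⟩ | ⟨-, rfl⟩
      · exact hki rfl
      · exact hkj rfl
    rcases eq_or_eq_of_fixed hg1 hne (by rw [h3, h.1, h.2.1, C.e_comm])
      (by rw [h3, h.2.2.1, h.2.2.2, C.e_comm]) hx with rfl | rfl
    · exact Or.inr ⟨i, j, hij, rfl⟩
    · exact Or.inr ⟨k, l, hkl, rfl⟩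

theorem exists_fixing (C : IsTetrahedralConfig G v f e) {x : ExtPlane}
    (hx : x ∈ Set.range v ∪ Set.range f ∪ {x | ∃ i j, i ≠ j ∧ e i j = x}) :
    ∃ g ∈ G, g ≠ 1 ∧ g • x = x := by
  have hne : ∀ (g : MoebiusGroup) (σ : Equiv.Perm (Fin 4)) (i : Fin 4), σ i ≠ i →
      ActsBy v f e g σ → g ≠ 1 := by
    rintro g σ i hi h rfl
    have := h.1 i
    rw [one_smul] at this
    exact hi (C.v_inj this).symm
  have h3 : ∀ i : Fin 4, ∃ g ∈ G, g ≠ 1 ∧ ∃ σ, σ i = i ∧ ActsBy v f e g σ := by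
    intro i
    obtain ⟨σ, hσ, hi, h⟩ := exists_even_three_cycle i
    obtain ⟨g, hg, hact⟩ := C.exists_mem σ hσ
    obtain ⟨j, hij⟩ := exists_ne_of_ne i
    exact ⟨g, hg, hne g σ j (fun hj => h i j hij (Or.inl ⟨hi, hj⟩)) hact, σ, hi, hact⟩
  rcases hx with (⟨i, rfl⟩ | ⟨i, rfl⟩) | ⟨i, j, hij, rfl⟩
  · obtain ⟨g, hg, hg1, σ, hi, hact⟩ := h3 i
    exact ⟨g, hg, hg1, by rw [hact.1, hi]⟩
  · obtain ⟨g, hg, hg1, σ, hi, hact⟩ := h3 i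
    exact ⟨g, hg, hg1, by rw [hact.2.1, hi]⟩
  · obtain ⟨σ, hσ, k, l, -, -, -, hi, hj, -⟩ := exists_even_double_swap hij
    obtain ⟨g, hg, hact⟩ := C.exists_mem σ hσ
    exact ⟨g, hg, hne g σ i (by rw [hi]; exact hij.symm) hact, by rw [hact.2.2, hi, hj, C.e_comm]⟩

/-- A₄ is 2-transitive on the vertices, so any symmetry can be corrected by some `g ∈ G` to fix `v
0` and `v 1`. It then commutes with the rotation about `v 0` taking `v 1` to `v 2`, so it fixes `v
2` as well and the product is trivial. -/
theorem stab_range_v_le (C : IsTetrahedralConfig G v f e) : stab (Set.range v) ≤ G := by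
  intro h hh
  have hfin := finite_stab (Set.finite_range v) (by rw [C.ncard_v]; norm_num)
  have hGH : ∀ g σ, ActsBy v f e g σ → g ∈ stab (Set.range v) := fun g σ hact =>
    mem_stab_of_forall (Set.finite_range v) (by rintro _ ⟨i, rfl⟩; exact ⟨σ i, (hact.1 i).symm⟩)
  obtain ⟨a, ha⟩ := smul_mem_of_mem_stab hh ⟨0, rfl⟩
  obtain ⟨b, hb⟩ := smul_mem_of_mem_stab hh ⟨1, rfl⟩
  have hab : a ≠ b := by
    rintro rfl
    rw [ha] at hb
    exact absurd (C.v_inj (smul_left_cancel h hb)) (by decide)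
  obtain ⟨σ, hσ, hσa, hσb⟩ := exists_even_map_pair hab (show (0 : Fin 4) ≠ 1 by decide)
  obtain ⟨g, hg, hact⟩ := C.exists_mem σ hσ
  obtain ⟨τ, hτ, hτ0, hτ1⟩ : ∃ τ ∈ alternatingGroup (Fin 4), τ 0 = 0 ∧ τ 1 = 2 :=
    exists_even_map_pair (by decide) (by decide)
  obtain ⟨r, hr, hract⟩ := C.exists_mem τ hτ
  have h0 : (g * h) • v 0 = v 0 := by rw [mul_smul, ← ha, hact.1, hσa]
  have h1 : (g * h) • v 1 = v 1 := by rw [mul_smul, ← hb, hact.1, hσb]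
  have hcomm := commute_of_common_fixed (mul_mem (hGH g σ hact) hh) (hGH r τ hract) h0
    (by rw [hract.1, hτ0])
  have h2 : (g * h) • v 2 = v 2 := by
    have : v 2 = r • v 1 := by rw [hract.1, hτ1]
    rw [this, ← mul_smul, hcomm, mul_smul, h1]
  have := eq_one_of_three_fixed (C.v_inj.ne (by decide)) (C.v_inj.ne (by decide))
    (C.v_inj.ne (by decide)) h0 h1 h2
  rw [mul_eq_one_iff_inv_eq] at this
  exact this ▸ G.inv_mem hg

/-- It suffices that no symmetry `h` sends a vertex `v i` to an edge point. If it did, the conjugate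
by `h` of the 3-fold rotation `r` about `v i` would share a fixed point with a half-turn `s`, hence
commute with it and fix the opposite edge point too. Pulled back by `h`, that point is a second
fixed point of `r` in `V ∪ E`; but the second fixed point of `r` is a face point. -/
theorem stab_v_union_e_le (C : IsTetrahedralConfig G v f e) :
    stab (Set.range v ∪ {x | ∃ i j, i ≠ j ∧ e i j = x}) ≤ G := by
  set E := {x | ∃ i j, i ≠ j ∧ e i j = x} with hE
  have hEfin : E.Finite := Set.finite_of_ncard_ne_zero (by rw [C.ncard_e]; norm_num)
  have hαfin : (Set.range v ∪ E).Finite := (Set.finite_range v).union hEfin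
  have hcard : 2 < (Set.range v ∪ E).ncard :=
    lt_of_lt_of_le (by rw [C.ncard_v]; norm_num) (Set.ncard_le_ncard Set.subset_union_left hαfin)
  have hfin := finite_stab hαfin hcard
  have hGH : ∀ g σ, ActsBy v f e g σ → g ∈ stab (Set.range v ∪ E) := fun g σ hact =>
    mem_stab_of_forall hαfin (by
      rintro _ (⟨i, rfl⟩ | ⟨i, j, hij, rfl⟩)
      · exact Or.inl ⟨σ i, (hact.1 i).symm⟩
      · exact Or.inr ⟨σ i, σ j, σ.injective.ne hij, (hact.2.2 i j).symm⟩)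
  intro h hh
  apply C.stab_range_v_le
  apply mem_stab_of_forall (Set.finite_range v)
  rintro _ ⟨i, rfl⟩
  refine (smul_mem_of_mem_stab hh (Or.inl ⟨i, rfl⟩)).resolve_right ?_
  rintro ⟨j, k, hjk, hhi⟩
  obtain ⟨σ, hσ, hσi, hσne⟩ := exists_even_three_cycle i
  obtain ⟨r, hr, hract⟩ := C.exists_mem σ hσ
  obtain ⟨τ, hτ, l, m, hlm, hlj, hlk, hτj, hτk, hτl, hτm⟩ := exists_even_double_swap hjk
  obtain ⟨s, hs, hsact⟩ := C.exists_mem τ hτ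
  have hne : e j k ≠ e l m := fun heq => by
    rcases C.e_inj j k l m hjk hlm heq with ⟨rfl, -⟩ | ⟨-, rfl⟩
    · exact hlj rfl
    · exact hlk rfl
  have hs1 : s ≠ 1 := by
    rintro rfl
    have := hsact.1 j
    rw [one_smul, hτj] at this
    exact hjk (C.v_inj this)
  have hsjk : s • e j k = e j k := by rw [hsact.2.2, hτj, hτk, C.e_comm]
  have hslm : s • e l m = e l m := by rw [hsact.2.2, hτl, hτm, C.e_comm]
  have hrjk : (h * r * h⁻¹) • e j k = e j k := by
    rw [mul_smul, mul_smul, hhi, inv_smul_smul, hract.1, hσi]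
  have hcomm := commute_of_common_fixed
    (mul_mem (mul_mem hh (hGH r σ hract)) (inv_mem hh)) (hGH s τ hsact) hrjk hsjk
  -- The conjugate commutes with `s`, so it permutes the two fixed points of `s`; since it fixes `e
  -- j k`, it fixes `e l m`.
  have hrlm : (h * r * h⁻¹) • e l m = e l m := by
    have hfix : s • (h * r * h⁻¹) • e l m = (h * r * h⁻¹) • e l m := by
      rw [← mul_smul, ← hcomm, mul_smul, hslm]
    refine (eq_or_eq_of_fixed hs1 hne hsjk hslm hfix).resolve_left fun h1 => ?_
    exact hne (smul_left_cancel (h * r * h⁻¹) (hrjk.trans h1.symm))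
  have hfix : r • h⁻¹ • e l m = h⁻¹ • e l m := by
    rw [mul_smul, mul_smul] at hrlm
    exact eq_inv_smul_iff.2 hrlm
  rcases smul_mem_of_mem_stab (inv_mem hh) (x := e l m) (Or.inr ⟨l, m, hlm, rfl⟩) with
    ⟨p, hp⟩ | ⟨p, q, hpq, hp⟩
  · rw [← hp, hract.1] at hfix
    have hpi : i ≠ p := by
      rintro rfl
      rw [eq_inv_smul_iff, ← hhi] at hp
      exact hne hp
    exact hσne i p hpi (Or.inl ⟨hσi, C.v_inj hfix⟩)
  · rw [← hp, hract.2.2] at hfix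
    exact hσne p q hpq (C.e_inj _ _ _ _ (σ.injective.ne hpq) hpq hfix)

end IsTetrahedralConfig

/-! ### Orbit sizes and the well-definedness of the index -/

/-- The orbits of `G` that meet `α` and have `n` elements. -/
def orbitsIn (G : Subgroup MoebiusGroup) (α : Set ExtPlane) (n : ℕ) : Set (Set ExtPlane) :=
  {O | (∃ x ∈ α, O = MulAction.orbit G x) ∧ O.ncard = n}

theorem card_eq_twelve {G : Subgroup MoebiusGroup}
    (hG : Nonempty (G ≃* alternatingGroup (Fin 4))) : Nat.card G = 12 := by
  obtain ⟨i⟩ := hG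
  rw [Nat.card_congr i.toEquiv]
  have := two_mul_nat_card_alternatingGroup (α := Fin 4)
  rw [Nat.card_perm, Nat.card_fin] at this
  simp only [Nat.factorial] at this
  omega

/-- The facts about the orbits of `G` that follow from the tetrahedral triple. -/
structure IsOrbitTriple (G : Subgroup MoebiusGroup) (V F E : Set ExtPlane) : Prop where
  orbit_V : ∀ x ∈ V, MulAction.orbit G x = V
  orbit_F : ∀ x ∈ F, MulAction.orbit G x = F
  orbit_E : ∀ x ∈ E, MulAction.orbit G x = E
  ncard_V : V.ncard = 4
  ncard_F : F.ncard = 4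
  ncard_E : E.ncard = 6
  V_ne_F : V ≠ F
  ncard_B : ∀ O ∈ orbitsB G V F E, O.ncard = 12
  fixed : ∀ x ∈ V ∪ F ∪ E, ∃ g ∈ G, g ≠ 1 ∧ g • x = x

theorem IsTetrahedralConfig.isOrbitTriple {G : Subgroup MoebiusGroup} {v f : Fin 4 → ExtPlane}
    {e : Fin 4 → Fin 4 → ExtPlane} (hG : Nonempty (G ≃* alternatingGroup (Fin 4)))
    (C : IsTetrahedralConfig G v f e) :
    IsOrbitTriple G (Set.range v) (Set.range f) {x | ∃ i j, i ≠ j ∧ e i j = x} where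
  orbit_V := by rintro _ ⟨i, rfl⟩; exact C.orbit_v i
  orbit_F := by rintro _ ⟨i, rfl⟩; exact C.orbit_f i
  orbit_E := by rintro _ ⟨i, j, hij, rfl⟩; exact C.orbit_e hij
  ncard_V := C.ncard_v
  ncard_F := C.ncard_f
  ncard_E := C.ncard_e
  V_ne_F := C.range_v_ne_range_f
  ncard_B := by
    rintro _ ⟨x, hx, rfl⟩
    rw [MulAction.orbit, Set.ncard_range_of_injective, card_eq_twelve hG]
    intro g h hgh
    by_contra hne
    refine hx (C.mem_of_fixed (g := (h : MoebiusGroup)⁻¹ * g)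
      (G.mul_mem (G.inv_mem h.2) g.2) (fun h1 => hne ?_) ?_)
    · exact Subtype.ext (inv_mul_eq_one.1 h1).symm
    · rw [mul_smul, inv_smul_eq_iff]
      exact hgh
  fixed := fun _ hx => C.exists_fixing hx

theorem IsTetrahedralTriple.isOrbitTriple {G : Subgroup MoebiusGroup}
    (hG : Nonempty (G ≃* alternatingGroup (Fin 4))) {V F E : Set ExtPlane}
    (h : IsTetrahedralTriple G V F E) : IsOrbitTriple G V F E := by
  obtain ⟨v, f, e, C, rfl, rfl, rfl⟩ := h.exists_config hG
  exact C.isOrbitTriple hG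

namespace IsOrbitTriple

variable {G : Subgroup MoebiusGroup} {V F E : Set ExtPlane}

theorem exists_orbit_eq (h : IsOrbitTriple G V F E) {O : Set ExtPlane}
    (hO : O ∈ ({V, F, E} : Set (Set ExtPlane)) ∪ orbitsB G V F E) :
    O.Nonempty ∧ ∀ x ∈ O, MulAction.orbit G x = O := by
  have hne : ∀ {S : Set ExtPlane} {n : ℕ}, S.ncard = n + 1 → S.Nonempty := fun hS =>
    Set.nonempty_of_ncard_ne_zero (by rw [hS]; exact Nat.succ_ne_zero _)
  rcases hO with (rfl | rfl | rfl) | ⟨x, -, rfl⟩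
  · exact ⟨hne h.ncard_V, h.orbit_V⟩
  · exact ⟨hne h.ncard_F, h.orbit_F⟩
  · exact ⟨hne h.ncard_E, h.orbit_E⟩
  · exact ⟨⟨x, MulAction.mem_orbit_self x⟩, fun y hy => MulAction.orbit_eq_iff.2 hy⟩

theorem orbit_mem (h : IsOrbitTriple G V F E) (x : ExtPlane) :
    MulAction.orbit G x ∈ ({V, F, E} : Set (Set ExtPlane)) ∪ orbitsB G V F E := by
  by_cases hx : x ∈ V ∪ F ∪ E
  · left
    rcases hx with (hx | hx) | hx
    · rw [h.orbit_V x hx]; simp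
    · rw [h.orbit_F x hx]; simp
    · rw [h.orbit_E x hx]; simp
  · exact Or.inr ⟨x, hx, rfl⟩

theorem inter_V_F_eq (h : IsOrbitTriple G V F E) {𝒪 : Set (Set ExtPlane)}
    (hO : 𝒪 ⊆ {V, F, E} ∪ orbitsB G V F E) : 𝒪 ∩ {V, F} = {O ∈ 𝒪 | O.ncard = 4} := by
  ext O
  constructor
  · rintro ⟨hm, rfl | rfl⟩
    exacts [⟨hm, h.ncard_V⟩, ⟨hm, h.ncard_F⟩]
  · rintro ⟨hm, h4⟩
    refine ⟨hm, ?_⟩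
    rcases hO hm with (rfl | rfl | rfl) | hB
    · simp
    · simp
    · rw [h.ncard_E] at h4; omega
    · rw [h.ncard_B O hB] at h4; omega

theorem inter_E_eq (h : IsOrbitTriple G V F E) {𝒪 : Set (Set ExtPlane)}
    (hO : 𝒪 ⊆ {V, F, E} ∪ orbitsB G V F E) : 𝒪 ∩ {E} = {O ∈ 𝒪 | O.ncard = 6} := by
  ext O
  constructor
  · rintro ⟨hm, rfl⟩
    exact ⟨hm, h.ncard_E⟩
  · rintro ⟨hm, h4⟩
    refine ⟨hm, ?_⟩
    rcases hO hm with (rfl | rfl | rfl) | hB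
    · rw [h.ncard_V] at h4; omega
    · rw [h.ncard_F] at h4; omega
    · simp
    · rw [h.ncard_B O hB] at h4; omega

theorem inter_orbitsB_eq (h : IsOrbitTriple G V F E) {𝒪 : Set (Set ExtPlane)}
    (hO : 𝒪 ⊆ {V, F, E} ∪ orbitsB G V F E) :
    𝒪 ∩ orbitsB G V F E = {O ∈ 𝒪 | O.ncard = 12} := by
  ext O
  constructor
  · rintro ⟨hm, hB⟩
    exact ⟨hm, h.ncard_B O hB⟩
  · rintro ⟨hm, h4⟩
    refine ⟨hm, ?_⟩
    rcases hO hm with (rfl | rfl | rfl) | hB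
    · rw [h.ncard_V] at h4; omega
    · rw [h.ncard_F] at h4; omega
    · rw [h.ncard_E] at h4; omega
    · exact hB

theorem ncard_sUnion (h : IsOrbitTriple G V F E) {𝒪 : Set (Set ExtPlane)} (hfin : 𝒪.Finite)
    (hO : 𝒪 ⊆ {V, F, E} ∪ orbitsB G V F E) :
    (⋃₀ 𝒪).ncard = 4 * (𝒪 ∩ {V, F}).ncard + 6 * (𝒪 ∩ {E}).ncard +
      12 * (𝒪 ∩ orbitsB G V F E).ncard := by
  classical
  have hcard : ∀ O ∈ 𝒪, O.ncard = 4 ∨ O.ncard = 6 ∨ O.ncard = 12 := by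
    intro O hm
    rcases hO hm with (rfl | rfl | rfl) | hB
    · exact Or.inl h.ncard_V
    · exact Or.inl h.ncard_F
    · exact Or.inr (Or.inl h.ncard_E)
    · exact Or.inr (Or.inr (h.ncard_B O hB))
  have hdisj : 𝒪.PairwiseDisjoint id := by
    intro O hm P hp hne
    rw [Function.onFun, id, id, Set.disjoint_left]
    intro x hx hx'
    exact hne (((h.exists_orbit_eq (hO hm)).2 x hx).symm.trans ((h.exists_orbit_eq (hO hp)).2 x hx'))
  have hU : (⋃₀ 𝒪).ncard = ∑ᶠ O ∈ 𝒪, O.ncard := by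
    rw [Set.sUnion_eq_biUnion]
    exact hfin.ncard_biUnion (s := id) (fun O hm => Set.finite_of_ncard_ne_zero
      (by rcases hcard O hm with h | h | h <;> simp [h])) hdisj
  have hset : ∀ n, {O ∈ 𝒪 | O.ncard = n} = ((hfin.toFinset.filter fun O => O.ncard = n : Finset _) :
      Set (Set ExtPlane)) := fun n => by ext; simp
  rw [h.inter_V_F_eq hO, h.inter_E_eq hO, h.inter_orbitsB_eq hO, hset, hset, hset,
    Set.ncard_coe_finset, Set.ncard_coe_finset, Set.ncard_coe_finset, hU,
    finsum_mem_eq_finite_toFinset_sum _ hfin]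
  simp only [Finset.card_filter, Finset.mul_sum, ← Finset.sum_add_distrib]
  refine Finset.sum_congr rfl fun O hm => ?_
  rcases hcard O (hfin.mem_toFinset.1 hm) with h | h | h <;> simp [h]

/-- The family of orbits can be recovered from its union, which makes the index a function of `α`.
-/
theorem eq_setOf_orbit (h : IsOrbitTriple G V F E) {𝒪 : Set (Set ExtPlane)}
    (hO : 𝒪 ⊆ {V, F, E} ∪ orbitsB G V F E) :
    𝒪 = {O | ∃ x ∈ ⋃₀ 𝒪, O = MulAction.orbit G x} := by
  ext O
  constructor
  · intro hm
    obtain ⟨⟨x, hx⟩, hx'⟩ := h.exists_orbit_eq (hO hm)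
    exact ⟨x, ⟨O, hm, hx⟩, (hx' x hx).symm⟩
  · rintro ⟨x, ⟨P, hP, hx⟩, rfl⟩
    rw [(h.exists_orbit_eq (hO hP)).2 x hx]
    exact hP

end IsOrbitTriple

/-- The right-hand sides do not mention `V`, `F`, `E`, so the index is independent of the
tetrahedron and of the coordinate chosen. -/
theorem HasTetrahedralIndex.eq_ncard {G : Subgroup MoebiusGroup} {α : Set ExtPlane} {ν ε k : ℕ}
    (h : HasTetrahedralIndex G α ν ε k) : ν = (orbitsIn G α 4).ncard ∧
      ε = (orbitsIn G α 6).ncard ∧ k = (orbitsIn G α 12).ncard := by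
  obtain ⟨hG, V, F, E, ht, 𝒪, hfin, hO, rfl, rfl, rfl, rfl⟩ := h
  have h := ht.isOrbitTriple hG
  have heq := h.eq_setOf_orbit hO
  have key : ∀ n, {O ∈ 𝒪 | O.ncard = n} = orbitsIn G (⋃₀ 𝒪) n := by
    intro n
    conv_lhs => rw [heq]
    rfl
  rw [h.inter_V_F_eq hO, h.inter_E_eq hO, h.inter_orbitsB_eq hO, key, key, key]
  exact ⟨rfl, rfl, rfl⟩

theorem HasTetrahedralIndex.ncard_eq {G : Subgroup MoebiusGroup} {α : Set ExtPlane} {ν ε k : ℕ}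
    (h : HasTetrahedralIndex G α ν ε k) : α.ncard = 4 * ν + 6 * ε + 12 * k := by
  obtain ⟨hG, V, F, E, ht, 𝒪, hfin, hO, rfl, rfl, rfl, rfl⟩ := h
  exact (ht.isOrbitTriple hG).ncard_sUnion hfin hO

theorem HasTetrahedralIndex.le {G : Subgroup MoebiusGroup} {α : Set ExtPlane} {ν ε k : ℕ}
    (h : HasTetrahedralIndex G α ν ε k) : ν ≤ 2 ∧ ε ≤ 1 := by
  obtain ⟨hG, V, F, E, ht, 𝒪, hfin, hO, rfl, rfl, rfl, rfl⟩ := h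
  constructor
  · exact (Set.ncard_le_ncard Set.inter_subset_right).trans (Set.ncard_insert_le V {F} |>.trans
      (by rw [Set.ncard_singleton]))
  · exact (Set.ncard_le_ncard Set.inter_subset_right).trans (by rw [Set.ncard_singleton])

theorem exists_hasTetrahedralIndex {G : Subgroup MoebiusGroup} {V F E α : Set ExtPlane}
    (hG : Nonempty (G ≃* alternatingGroup (Fin 4))) (ht : IsTetrahedralTriple G V F E)
    (hα : α.Finite) (hGα : ∀ g ∈ G, ∀ x ∈ α, g • x ∈ α) :
    ∃ ν ε k, HasTetrahedralIndex G α ν ε k := by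
  have h := ht.isOrbitTriple hG
  refine ⟨_, _, _, hG, V, F, E, ht, (fun x => MulAction.orbit G x) '' α, hα.image _, ?_, ?_, rfl,
    rfl, rfl⟩
  · rintro _ ⟨x, -, rfl⟩
    exact h.orbit_mem x
  · apply Set.Subset.antisymm
    · rintro y ⟨_, ⟨x, hx, rfl⟩, g, rfl⟩
      exact hGα g g.2 x hx
    · intro x hx
      exact ⟨_, ⟨x, hx, rfl⟩, MulAction.mem_orbit_self x⟩

/-! ### The standard tetrahedron and its rotation group -/

section Rotation

theorem toEuclideanLin_mul_apply (A B : Matrix (Fin 3) (Fin 3) ℝ) (x : Space) :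
    Matrix.toEuclideanLin (A * B) x = Matrix.toEuclideanLin A (Matrix.toEuclideanLin B x) := by
  simp [Matrix.toLpLin_apply, Matrix.mulVec_mulVec]

theorem norm_toEuclideanLin {A : Matrix (Fin 3) (Fin 3) ℝ}
    (hA : A ∈ Matrix.specialOrthogonalGroup (Fin 3) ℝ) (x : Space) :
    ‖Matrix.toEuclideanLin A x‖ = ‖x‖ := by
  have h := (Matrix.mem_orthogonalGroup_iff' _ _).1 (Matrix.mem_specialOrthogonalGroup_iff.1 hA).1
  rw [← sq_eq_sq₀ (norm_nonneg _) (norm_nonneg _), ← real_inner_self_eq_norm_sq,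
    ← LinearMap.adjoint_inner_left, ← Matrix.toEuclideanLin_conjTranspose_eq_adjoint,
    ← toEuclideanLin_mul_apply, Matrix.conjTranspose_eq_transpose_of_trivial]
  rw [h, Matrix.toLpLin_apply, Matrix.one_mulVec, real_inner_self_eq_norm_sq]

theorem transpose_mem_specialOrthogonalGroup {A : Matrix (Fin 3) (Fin 3) ℝ}
    (hA : A ∈ Matrix.specialOrthogonalGroup (Fin 3) ℝ) :
    A.transpose ∈ Matrix.specialOrthogonalGroup (Fin 3) ℝ := by
  rw [Matrix.mem_specialOrthogonalGroup_iff] at hA ⊢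
  refine ⟨?_, by rw [Matrix.det_transpose, hA.2]⟩
  rw [Matrix.mem_orthogonalGroup_iff, Matrix.transpose_transpose]
  exact (Matrix.mem_orthogonalGroup_iff' _ _).1 hA.1

variable {T : Affine.Simplex ℝ Space 3}

theorem ActsAsRotationOf.one : ActsAsRotationOf T 1 :=
  ⟨1, one_mem _, by simp, by simp⟩

theorem ActsAsRotationOf.mul {g h : MoebiusGroup} (hg : ActsAsRotationOf T g)
    (hh : ActsAsRotationOf T h) : ActsAsRotationOf T (g * h) := by
  obtain ⟨A, hA, hAT, hAs⟩ := hg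
  obtain ⟨B, hB, hBT, hBs⟩ := hh
  refine ⟨A * B, mul_mem hA hB, ?_, fun x hx => ?_⟩
  · have : ⇑(Matrix.toEuclideanLin (A * B)) = Matrix.toEuclideanLin A ∘ Matrix.toEuclideanLin B :=
      funext (toEuclideanLin_mul_apply A B)
    rw [this, Set.image_comp, hBT, hAT]
  · rw [mul_smul, hBs x hx, hAs _ (by rw [norm_toEuclideanLin hB, hx]), toEuclideanLin_mul_apply]

theorem ActsAsRotationOf.inv {g : MoebiusGroup} (hg : ActsAsRotationOf T g) :
    ActsAsRotationOf T g⁻¹ := by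
  obtain ⟨A, hA, hAT, hAs⟩ := hg
  have hA' := transpose_mem_specialOrthogonalGroup hA
  have h1 : ∀ x, Matrix.toEuclideanLin (A.transpose) (Matrix.toEuclideanLin A x) = x := fun x => by
    rw [← toEuclideanLin_mul_apply,
      (Matrix.mem_orthogonalGroup_iff' _ _).1 (Matrix.mem_specialOrthogonalGroup_iff.1 hA).1]
    simp
  have h2 : ∀ x, Matrix.toEuclideanLin A (Matrix.toEuclideanLin (A.transpose) x) = x := fun x => by
    rw [← toEuclideanLin_mul_apply,
      (Matrix.mem_orthogonalGroup_iff _ _).1 (Matrix.mem_specialOrthogonalGroup_iff.1 hA).1]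
    simp
  refine ⟨A.transpose, hA', ?_, fun x hx => ?_⟩
  · nth_rw 1 [← hAT]
    rw [← Set.image_comp]
    simp [h1]
  · rw [inv_smul_eq_iff, hAs _ (by rw [norm_toEuclideanLin hA', hx]), h2]

end Rotation

/-- The vertices of the standard tetrahedron. -/
noncomputable def stdPoints : Fin 4 → Space :=
  ![(√3)⁻¹ • !₂[1, 1, 1], (√3)⁻¹ • !₂[1, -1, -1], (√3)⁻¹ • !₂[-1, 1, -1], (√3)⁻¹ • !₂[-1, -1, 1]]

theorem affineIndependent_stdPoints : AffineIndependent ℝ stdPoints := by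
  rw [affineIndependent_iff_of_fintype]
  intro w hw h
  rw [Finset.univ.weightedVSub_eq_weightedVSubOfPoint_of_sum_eq_zero _ _ hw (0 : Space),
    Finset.weightedVSubOfPoint_apply] at h
  simp only [vsub_eq_sub, sub_zero] at h
  rw [Fin.sum_univ_four] at h
  rw [Fin.sum_univ_four] at hw
  have h3 : (√3)⁻¹ ≠ 0 := by positivity
  have e0 := congrArg (fun x : Space => x 0) h
  have e1 := congrArg (fun x : Space => x 1) h
  have e2 := congrArg (fun x : Space => x 2) h
  simp only [stdPoints, Matrix.cons_val_zero, Matrix.cons_val_one, Matrix.cons_val, PiLp.add_apply,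
    PiLp.smul_apply, smul_eq_mul, PiLp.zero_apply] at e0 e1 e2
  have f0 : w 0 + w 1 - w 2 - w 3 = 0 := mul_left_cancel₀ h3 (by linear_combination e0)
  have f1 : w 0 - w 1 + w 2 - w 3 = 0 := mul_left_cancel₀ h3 (by linear_combination e1)
  have f2 : w 0 - w 1 - w 2 + w 3 = 0 := mul_left_cancel₀ h3 (by linear_combination e2)
  intro i
  fin_cases i <;> simp only [Fin.mk_one, Fin.zero_eta, Fin.reduceFinMk] <;> linarith

/-- The standard tetrahedron. -/
noncomputable def stdSimplex3 : Affine.Simplex ℝ Space 3 := ⟨stdPoints, affineIndependent_stdPoints⟩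

theorem isInscribedRegular_std : IsInscribedRegular stdSimplex3 := by
  have h3 : (√3)⁻¹ ^ 2 = 1 / 3 := by
    rw [inv_pow, Real.sq_sqrt (by norm_num)]; norm_num
  constructor
  · intro i
    rw [← pow_eq_one_iff_of_nonneg (norm_nonneg _) two_ne_zero, norm_sq_space]
    fin_cases i <;> simp [stdSimplex3, stdPoints] <;> norm_num
  -- Two vertices differ in exactly two coordinates, by `2 / √3` in each, so the squared edge length
  -- is `8 / 3`.
  · refine ⟨√(8 / 3), fun i j hij => ?_⟩
    rw [dist_eq_norm, ← Real.sqrt_sq (norm_nonneg _), norm_sq_space]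
    congr 1
    simp only [PiLp.sub_apply, stdSimplex3, stdPoints]
    fin_cases i <;> fin_cases j <;> first
      | exact absurd rfl hij
      | (simp only [Matrix.cons_val_zero, Matrix.cons_val_one, Matrix.cons_val,
          PiLp.smul_apply, smul_eq_mul, Fin.mk_one, Fin.zero_eta, Fin.reduceFinMk]
         linear_combination 8 * h3)

/-- The transformation `z ↦ l z`. -/
noncomputable def dil (l : ℂ) (hl : l ≠ 0) : MoebiusGroup := mob l 0 0 1 (by simpa using hl)

theorem dil_smul_coe {l : ℂ} (hl : l ≠ 0) (z : ℂ) :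
    dil l hl • (z : ExtPlane) = ((l * z : ℂ) : ExtPlane) := by
  rw [dil, mob_smul_coe]; simp

theorem dil_smul_infty {l : ℂ} (hl : l ≠ 0) : dil l hl • (∞ : ExtPlane) = ∞ := by
  rw [dil, mob_smul_infty]; simp

/-- The transformation `z ↦ 1 / z`. -/
noncomputable def recip : MoebiusGroup := mob 0 1 1 0 (by simp)

theorem recip_smul_coe {z : ℂ} (hz : z ≠ 0) :
    recip • (z : ExtPlane) = ((z⁻¹ : ℂ) : ExtPlane) := by
  rw [recip, mob_smul_coe]; simp [hz]

theorem recip_smul_zero : recip • ((0 : ℂ) : ExtPlane) = ∞ := by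
  rw [recip, mob_smul_coe]; simp

theorem recip_smul_infty : recip • (∞ : ExtPlane) = ((0 : ℂ) : ExtPlane) := by
  rw [recip, mob_smul_infty]; simp

/-- The rotation by `2π/3` about the axis through `(1, 1, 1)`, as a Möbius transformation. -/
noncomputable def rot3 : MoebiusGroup :=
  mob Complex.I Complex.I 1 (-1) (by
    intro h
    have : Complex.I = 0 := by linear_combination -h / 2
    exact Complex.I_ne_zero this)

theorem moebius_eq_of_three {g h : MoebiusGroup} (h0 : g • ((0 : ℂ) : ExtPlane) = h • ((0 : ℂ) : ExtPlane))
    (h1 : g • ((1 : ℂ) : ExtPlane) = h • ((1 : ℂ) : ExtPlane))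
    (h2 : g • (∞ : ExtPlane) = h • (∞ : ExtPlane)) : g = h := by
  have := eq_one_of_three_fixed (g := h⁻¹ * g) (p := ((0 : ℂ) : ExtPlane)) (q := ((1 : ℂ) : ExtPlane))
    (r := ∞) (by simp) (OnePoint.coe_ne_infty _) (OnePoint.coe_ne_infty _)
    (by rw [mul_smul, h0, inv_smul_smul]) (by rw [mul_smul, h1, inv_smul_smul])
    (by rw [mul_smul, h2, inv_smul_smul])
  exact (inv_mul_eq_one.1 this).symm

theorem dil_mul_dil {l m : ℂ} (hl : l ≠ 0) (hm : m ≠ 0) :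
    dil l hl * dil m hm = dil (l * m) (mul_ne_zero hl hm) := by
  apply moebius_eq_of_three <;> simp [mul_smul, dil_smul_coe, dil_smul_infty]

theorem dil_one : dil 1 one_ne_zero = 1 := by
  apply moebius_eq_of_three <;> simp [dil_smul_coe, dil_smul_infty]

theorem dil_inj {l m : ℂ} {hl : l ≠ 0} {hm : m ≠ 0} (h : dil l hl = dil m hm) : l = m := by
  have := congrArg (fun g : MoebiusGroup => g • ((1 : ℂ) : ExtPlane)) h
  simpa [dil_smul_coe] using this

theorem recip_mul_dil {l : ℂ} (hl : l ≠ 0) :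
    recip * dil l hl = dil l⁻¹ (inv_ne_zero hl) * recip := by
  apply moebius_eq_of_three <;>
    simp [mul_smul, dil_smul_coe, dil_smul_infty, recip_smul_coe, recip_smul_zero,
      recip_smul_infty, hl]

theorem recip_mul_recip : recip * recip = 1 := by
  apply moebius_eq_of_three <;>
    simp [mul_smul, recip_smul_coe, recip_smul_zero, recip_smul_infty]

theorem exists_eq_dil {g : MoebiusGroup} (h : g • (∞ : ExtPlane) = ∞)
    (h0 : g • ((0 : ℂ) : ExtPlane) = ((0 : ℂ) : ExtPlane)) : ∃ l hl, g = dil l hl := by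
  obtain ⟨a, b, ha, hab⟩ := exists_affine h
  have hb : b = 0 := by
    rw [hab, OnePoint.coe_eq_coe] at h0
    simpa using h0
  subst hb
  refine ⟨a, ha, moebius_eq_of_three ?_ ?_ ?_⟩ <;> simp [hab, dil_smul_coe, dil_smul_infty, h]

/-- The half-turn about the vertical axis, as the Möbius transformation `z ↦ -z`. -/
noncomputable def negMob : MoebiusGroup := dil (-1) (by norm_num)

theorem actsAsRotationOf_std {g : MoebiusGroup} {A : Matrix (Fin 3) (Fin 3) ℝ}
    {σ : Equiv.Perm (Fin 4)} (hA : A ∈ Matrix.specialOrthogonalGroup (Fin 3) ℝ)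
    (hg : ∀ x : Space, ‖x‖ = 1 → g • stereo x = stereo (Matrix.toEuclideanLin A x))
    (hσ : ∀ i, Matrix.toEuclideanLin A (stdPoints i) = stdPoints (σ i)) :
    ActsAsRotationOf stdSimplex3 g ∧
      ∀ i, g • tetraV 1 stdSimplex3 i = tetraV 1 stdSimplex3 (σ i) := by
  refine ⟨⟨A, hA, ?_, hg⟩, fun i => ?_⟩
  · change _ '' Set.range stdPoints = Set.range stdPoints
    rw [← Set.range_comp, ← σ.surjective.range_comp stdPoints]
    congr 1
    funext i
    exact hσ i
  · simp only [tetraV, one_smul]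
    rw [hg _ (isInscribedRegular_std.1 i)]
    exact congrArg stereo (hσ i)

/-- The permutation of the vertices of the standard tetrahedron by `negMob`. -/
def permA : Equiv.Perm (Fin 4) := Equiv.swap 0 3 * Equiv.swap 1 2

/-- The permutation of the vertices of the standard tetrahedron by `recip`. -/
def permB : Equiv.Perm (Fin 4) := Equiv.swap 0 1 * Equiv.swap 2 3

/-- The permutation of the vertices of the standard tetrahedron by `rot3`. -/
def permC : Equiv.Perm (Fin 4) := Equiv.swap 1 3 * Equiv.swap 3 2

theorem toEuclideanLin_coord (A : Matrix (Fin 3) (Fin 3) ℝ) (x : Space) (i : Fin 3) :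
    Matrix.toEuclideanLin A x i = A i 0 * x 0 + A i 1 * x 1 + A i 2 * x 2 := by
  rw [Matrix.toLpLin_apply]
  simp [Matrix.mulVec, dotProduct, Fin.sum_univ_three]

theorem space_ext {x y : Space} (h0 : x 0 = y 0) (h1 : x 1 = y 1) (h2 : x 2 = y 2) : x = y := by
  ext i
  fin_cases i
  exacts [h0, h1, h2]

theorem negMob_acts : ActsAsRotationOf stdSimplex3 negMob ∧
    ∀ i, negMob • tetraV 1 stdSimplex3 i = tetraV 1 stdSimplex3 (permA i) := by
  refine actsAsRotationOf_std (A := !![-1, 0, 0; 0, -1, 0; 0, 0, 1]) ?_ (fun x hx => ?_)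
    (fun i => ?_)
  · rw [Matrix.mem_specialOrthogonalGroup_iff, Matrix.mem_orthogonalGroup_iff]
    constructor
    · ext i j
      fin_cases i <;> fin_cases j <;> simp [Matrix.mul_apply, Fin.sum_univ_three]
    · simp [Matrix.det_fin_three]
  · simp only [stereo, toEuclideanLin_coord]
    by_cases h : x 2 = 1
    · simp [h, negMob, dil_smul_infty]
    · simp only [h, if_false, negMob, dil_smul_coe]
      simp [h]
      apply Complex.ext <;> simp [neg_div]
  · apply space_ext <;> rw [toEuclideanLin_coord] <;> fin_cases i <;>
      simp [permA, stdPoints, Equiv.swap_apply_def]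

theorem recip_acts : ActsAsRotationOf stdSimplex3 recip ∧
    ∀ i, recip • tetraV 1 stdSimplex3 i = tetraV 1 stdSimplex3 (permB i) := by
  refine actsAsRotationOf_std (A := !![1, 0, 0; 0, -1, 0; 0, 0, -1]) ?_ (fun x hx => ?_)
    (fun i => ?_)
  · rw [Matrix.mem_specialOrthogonalGroup_iff, Matrix.mem_orthogonalGroup_iff]
    constructor
    · ext i j
      fin_cases i <;> fin_cases j <;> simp [Matrix.mul_apply, Fin.sum_univ_three]
    · simp [Matrix.det_fin_three]
  · have hx' := norm_sq_space x
    rw [hx] at hx'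
    by_cases h : x 2 = 1
    · rw [h] at hx'
      have e1 : x 0 = 0 := by nlinarith [sq_nonneg (x 0), sq_nonneg (x 1)]
      have e2 : x 1 = 0 := by nlinarith [sq_nonneg (x 0), sq_nonneg (x 1)]
      simp only [stereo, toEuclideanLin_coord]
      simp [h, e1, e2, recip_smul_infty]
      norm_num
      rfl
    by_cases h' : x 2 = -1
    · rw [h'] at hx'
      have e1 : x 0 = 0 := by nlinarith [sq_nonneg (x 0), sq_nonneg (x 1)]
      have e2 : x 1 = 0 := by nlinarith [sq_nonneg (x 0), sq_nonneg (x 1)]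
      simp only [stereo, toEuclideanLin_coord]
      simp [h', e1, e2]
      norm_num
      exact recip_smul_zero
    · have h1 : 1 - x 2 ≠ 0 := fun hh => h (by linarith)
      have h2 : 1 + x 2 ≠ 0 := fun hh => h' (by linarith)
      -- Away from the poles the half-turn sends `(x 0 + i x 1) / (1 - x 2)` to `(x 0 - i x 1) / (1
      -- + x 2)`; these are reciprocal because `x 0 ^ 2 + x 1 ^ 2 = 1 - x 2 ^ 2`.
      have hmul : (⟨x 0 / (1 - x 2), x 1 / (1 - x 2)⟩ : ℂ) * ⟨x 0 / (1 + x 2), -x 1 / (1 + x 2)⟩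
          = 1 := by
        apply Complex.ext
        · simp only [Complex.mul_re, Complex.one_re]
          field_simp
          linear_combination -hx'
        · simp only [Complex.mul_im, Complex.one_im]
          field_simp
          ring
      have e : Matrix.toEuclideanLin !![1, 0, 0; 0, -1, 0; 0, 0, -1] x 2 ≠ 1 := by
        rw [toEuclideanLin_coord]
        intro hh
        simp at hh
        exact h' (by linarith)
      rw [stereo, stereo, if_neg h, if_neg e, recip_smul_coe (left_ne_zero_of_mul_eq_one hmul),
        inv_eq_of_mul_eq_one_right hmul]
      simp only [toEuclideanLin_coord]
      simp
  · apply space_ext <;> rw [toEuclideanLin_coord] <;> fin_cases i <;>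
      simp [permB, stdPoints, Equiv.swap_apply_def]

theorem rot3_acts : ActsAsRotationOf stdSimplex3 rot3 ∧
    ∀ i, rot3 • tetraV 1 stdSimplex3 i = tetraV 1 stdSimplex3 (permC i) := by
  refine actsAsRotationOf_std (A := !![0, 1, 0; 0, 0, 1; 1, 0, 0]) ?_ (fun x hx => ?_)
    (fun i => ?_)
  · rw [Matrix.mem_specialOrthogonalGroup_iff, Matrix.mem_orthogonalGroup_iff]
    constructor
    · ext i j
      fin_cases i <;> fin_cases j <;> simp [Matrix.mul_apply, Fin.sum_univ_three]
    · simp [Matrix.det_fin_three]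
  · have hx' := norm_sq_space x
    rw [hx] at hx'
    have hst : stereo (Matrix.toEuclideanLin !![0, 1, 0; 0, 0, 1; 1, 0, 0] x) =
        if x 0 = 1 then ∞ else ((⟨x 1 / (1 - x 0), x 2 / (1 - x 0)⟩ : ℂ) : ExtPlane) := by
      simp only [stereo, toEuclideanLin_coord]
      simp
    rw [hst]
    by_cases h : x 2 = 1
    · rw [h] at hx'
      have e1 : x 0 = 0 := by nlinarith [sq_nonneg (x 0), sq_nonneg (x 1)]
      have e2 : x 1 = 0 := by nlinarith [sq_nonneg (x 0), sq_nonneg (x 1)]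
      rw [stereo, if_pos h, rot3, mob_smul_infty, e1, e2, h]
      simp only [one_ne_zero, zero_ne_one, if_false]
      congr 1
      apply Complex.ext <;> simp
    have h1 : 1 - x 2 ≠ 0 := fun hh => h (by linarith)
    rw [stereo, if_neg h, rot3, mob_smul_coe]
    by_cases h0 : x 0 = 1
    · rw [h0] at hx'
      have e1 : x 1 = 0 := by nlinarith [sq_nonneg (x 1), sq_nonneg (x 2)]
      have e2 : x 2 = 0 := by nlinarith [sq_nonneg (x 1), sq_nonneg (x 2)]
      rw [if_pos h0, if_pos]
      rw [h0, e1, e2]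
      apply Complex.ext <;> simp
    · have h2 : 1 - x 0 ≠ 0 := fun hh => h0 (by linarith)
      -- The pole of `rot3` is `1`, the projection of `(1, 0, 0)`, which has just been treated.
      have hne : 1 * (⟨x 0 / (1 - x 2), x 1 / (1 - x 2)⟩ : ℂ) + -1 ≠ 0 := by
        intro hh
        have hre := congrArg Complex.re hh
        have him := congrArg Complex.im hh
        simp only [one_mul, Complex.add_re, Complex.neg_re, Complex.one_re, Complex.zero_re,
          Complex.add_im, Complex.neg_im, Complex.one_im, Complex.zero_im] at hre him
        field_simp at hre him
        have e1 : x 1 = 0 := by linarith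
        have e0 : x 0 = 1 - x 2 := by linarith
        rw [e1, e0] at hx'
        have : x 2 * (1 - x 2) = 0 := by linear_combination hx' / 2
        have e2 := (mul_eq_zero.1 this).resolve_right h1
        exact h0 (by rw [e0, e2]; ring)
      rw [if_neg h0, if_neg hne]
      congr 1
      rw [div_eq_iff hne]
      apply Complex.ext
      · simp
        field_simp
        ring
      · simp
        field_simp
        linear_combination hx'
  · apply space_ext <;> rw [toEuclideanLin_coord] <;> fin_cases i <;>
      simp [permC, stdPoints, Equiv.swap_apply_def]

/-- The group of rotations of the standard tetrahedron. -/
noncomputable def stdGroup : Subgroup MoebiusGroup := Subgroup.closure {negMob, recip, rot3}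

theorem negMob_mem : negMob ∈ stdGroup := Subgroup.subset_closure (by simp)

theorem recip_mem : recip ∈ stdGroup := Subgroup.subset_closure (by simp)

theorem rot3_mem : rot3 ∈ stdGroup := Subgroup.subset_closure (by simp)

theorem actsAsRotationOf_of_mem_stdGroup {g : MoebiusGroup} (hg : g ∈ stdGroup) :
    ActsAsRotationOf stdSimplex3 g := by
  induction hg using Subgroup.closure_induction with
  | mem x hx =>
    rcases hx with rfl | rfl | rfl
    exacts [negMob_acts.1, recip_acts.1, rot3_acts.1]
  | one => exact ActsAsRotationOf.one
  | mul x y _ _ hx hy => exact hx.mul hy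
  | inv x _ hx => exact hx.inv

theorem exists_even_of_mem_stdGroup {g : MoebiusGroup} (hg : g ∈ stdGroup) :
    ∃ σ ∈ alternatingGroup (Fin 4), ∀ i, g • tetraV 1 stdSimplex3 i = tetraV 1 stdSimplex3 (σ i) := by
  induction hg using Subgroup.closure_induction with
  | mem x hx =>
    rcases hx with rfl | rfl | rfl
    · exact ⟨permA, by rw [Equiv.Perm.mem_alternatingGroup]; decide, negMob_acts.2⟩
    · exact ⟨permB, by rw [Equiv.Perm.mem_alternatingGroup]; decide, recip_acts.2⟩
    · exact ⟨permC, by rw [Equiv.Perm.mem_alternatingGroup]; decide, rot3_acts.2⟩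
  | one => exact ⟨1, one_mem _, fun i => by simp⟩
  | mul x y _ _ hx hy =>
    obtain ⟨σ, hσ, h1⟩ := hx
    obtain ⟨τ, hτ, h2⟩ := hy
    exact ⟨σ * τ, mul_mem hσ hτ, fun i => by rw [mul_smul, h2, h1, Equiv.Perm.mul_apply]⟩
  | inv x _ hx =>
    obtain ⟨σ, hσ, h1⟩ := hx
    exact ⟨σ⁻¹, inv_mem hσ, fun i => by
      rw [inv_smul_eq_iff, h1, ← Equiv.Perm.mul_apply, mul_inv_cancel, Equiv.Perm.one_apply]⟩

/-- A₄ is the product of its Klein four-group, generated by `permA` and `permB`, and the cyclic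
group of the 3-cycle `permC`. -/
theorem even_eq_word {σ : Equiv.Perm (Fin 4)} (hσ : σ ∈ alternatingGroup (Fin 4)) :
    ∃ i j : Fin 2, ∃ k : Fin 3, σ = permA ^ (i : ℕ) * permB ^ (j : ℕ) * permC ^ (k : ℕ) := by
  rw [Equiv.Perm.mem_alternatingGroup] at hσ
  revert hσ
  revert σ
  decide

theorem exists_stdGroup_equiv : ∃ ι : stdGroup ≃* alternatingGroup (Fin 4),
    (ι ⟨negMob, negMob_mem⟩ : Equiv.Perm (Fin 4)) = permA ∧
    (ι ⟨recip, recip_mem⟩ : Equiv.Perm (Fin 4)) = permB ∧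
    (ι ⟨rot3, rot3_mem⟩ : Equiv.Perm (Fin 4)) = permC := by
  have hv := tetraV_injective isInscribedRegular_std 1
  obtain ⟨ρ, hρ, hact⟩ := exists_permHom (G := stdGroup) hv fun g hg =>
    ActsAsRotationOf.exists_actsBy isInscribedRegular_std (φ := 1)
      (by simpa using actsAsRotationOf_of_mem_stdGroup hg)
  have huniq : ∀ (g : stdGroup) (σ : Equiv.Perm (Fin 4)),
      (∀ i, (g : MoebiusGroup) • tetraV 1 stdSimplex3 i = tetraV 1 stdSimplex3 (σ i)) → ρ g = σ := by
    intro g σ h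
    ext1 i
    apply hv
    rw [← (hact g).1, h]
  have hA : ρ ⟨negMob, negMob_mem⟩ = permA := huniq _ _ negMob_acts.2
  have hB : ρ ⟨recip, recip_mem⟩ = permB := huniq _ _ recip_acts.2
  have hC : ρ ⟨rot3, rot3_mem⟩ = permC := huniq _ _ rot3_acts.2
  have hrange : ρ.range = alternatingGroup (Fin 4) := by
    apply le_antisymm
    · rintro _ ⟨g, rfl⟩
      obtain ⟨σ, hσ, h⟩ := exists_even_of_mem_stdGroup g.2
      rw [huniq g σ h]
      exact hσ
    · intro σ hσ
      obtain ⟨i, j, k, rfl⟩ := even_eq_word hσ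
      rw [← hA, ← hB, ← hC, ← map_pow, ← map_pow, ← map_pow, ← map_mul, ← map_mul]
      exact ⟨_, rfl⟩
  exact ⟨(MonoidHom.ofInjective hρ).trans (MulEquiv.subgroupCongr hrange), hA, hB, hC⟩

theorem stdGroup_equiv : Nonempty (stdGroup ≃* alternatingGroup (Fin 4)) := by
  obtain ⟨ι, -⟩ := exists_stdGroup_equiv
  exact ⟨ι⟩

/-! ### Conjugacy of all Möbius groups isomorphic to A₄ -/

/-- The elements corresponding to the generators `permA`, `permB`, `permC`, with their relations. -/
theorem exists_generators {G : Subgroup MoebiusGroup} (ι : G ≃* alternatingGroup (Fin 4))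
    {a b t : MoebiusGroup} (ha : a ∈ G) (hb : b ∈ G) (ht : t ∈ G)
    (hA : (ι ⟨a, ha⟩ : Equiv.Perm (Fin 4)) = permA) (hB : (ι ⟨b, hb⟩ : Equiv.Perm (Fin 4)) = permB)
    (hC : (ι ⟨t, ht⟩ : Equiv.Perm (Fin 4)) = permC) :
    a * a = 1 ∧ b * b = 1 ∧ a * b = b * a ∧ a ≠ 1 ∧ b ≠ 1 ∧ a ≠ b ∧ t * b = a * t ∧
      t * a = a * b * t ∧
      ∀ g ∈ G, ∃ i j k : ℕ, g = a ^ i * b ^ j * t ^ k := by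
  have hinj : Function.Injective fun g : G => (ι g : Equiv.Perm (Fin 4)) :=
    Subtype.val_injective.comp ι.injective
  set a' : G := ⟨a, ha⟩
  set b' : G := ⟨b, hb⟩
  set t' : G := ⟨t, ht⟩
  have e1 : a' * a' = 1 := hinj (by simp only [map_mul, map_one, Subgroup.coe_mul, Subgroup.coe_one, hA]; decide)
  have e2 : b' * b' = 1 := hinj (by simp only [map_mul, map_one, Subgroup.coe_mul, Subgroup.coe_one, hB]; decide)
  have e3 : a' * b' = b' * a' := hinj (by simp only [map_mul, Subgroup.coe_mul, hA, hB]; decide)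
  have e4 : t' * b' = a' * t' := hinj (by simp only [map_mul, Subgroup.coe_mul, hA, hB, hC]; decide)
  have e5 : t' * a' = a' * b' * t' :=
    hinj (by simp only [map_mul, Subgroup.coe_mul, hA, hB, hC]; decide)
  refine ⟨congrArg Subtype.val e1, congrArg Subtype.val e2, congrArg Subtype.val e3, ?_, ?_, ?_,
    congrArg Subtype.val e4, congrArg Subtype.val e5, ?_⟩
  · intro h
    have h' : a' = 1 := Subtype.ext h
    rw [h', map_one, Subgroup.coe_one] at hA
    exact absurd hA (by decide)
  · intro h
    have h' : b' = 1 := Subtype.ext h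
    rw [h', map_one, Subgroup.coe_one] at hB
    exact absurd hB (by decide)
  · intro h
    have h' : a' = b' := Subtype.ext h
    rw [h', hB] at hA
    exact absurd hA (by decide)
  · intro g hg
    obtain ⟨i, j, k, h⟩ := even_eq_word (ι ⟨g, hg⟩).2
    refine ⟨i, j, k, congrArg Subtype.val (hinj (a₁ := ⟨g, hg⟩)
      (a₂ := a' ^ (i : ℕ) * b' ^ (j : ℕ) * t' ^ (k : ℕ)) ?_)⟩
    simp only [map_mul, map_pow, Subgroup.coe_mul, Subgroup.coe_pow, hA, hB, hC, h]

/-- The multiplier of an affine involution squares to one, and multiplier `1` would leave a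
translation, which is an involution only if trivial. -/
theorem involution_affine {g : MoebiusGroup} (h2 : g * g = 1) (h1 : g ≠ 1)
    (hg : g • (∞ : ExtPlane) = ∞) :
    ∃ d : ℂ, ∀ z : ℂ, g • (z : ExtPlane) = ((-z + d : ℂ) : ExtPlane) := by
  obtain ⟨c, d, hc, hcd⟩ := exists_affine hg
  have hsq : ∀ z : ℂ, c * (c * z + d) + d = z := by
    intro z
    have := congrArg (fun g : MoebiusGroup => g • (z : ExtPlane)) h2
    simp only [mul_smul, hcd, one_smul, OnePoint.coe_eq_coe] at this
    exact this
  have h0 := hsq 0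
  have h1' := hsq 1
  have hc2 : (c - 1) * (c + 1) = 0 := by linear_combination h1' - h0
  rcases mul_eq_zero.1 hc2 with h | h
  · have hc1 : c = 1 := sub_eq_zero.1 h
    subst hc1
    have hd : d = 0 := by linear_combination h0 / 2
    subst hd
    exact absurd (moebius_eq_of_three (by simp [hcd]) (by simp [hcd]) (by simp [hg])) h1
  · have hc1 : c = -1 := eq_neg_of_add_eq_zero_left h
    subst hc1
    exact ⟨d, fun z => by rw [hcd]; congr 1; ring⟩

/-- With a common fixed point at `∞` the two involutions would be `-z + d` and `-z + d'`, which
commute only if `d = d'`. -/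
theorem smul_ne_of_fixed_of_commute {a b : MoebiusGroup} (ha : a * a = 1) (hb : b * b = 1)
    (hab : a * b = b * a) (ha1 : a ≠ 1) (hb1 : b ≠ 1) (hne : a ≠ b) {x : ExtPlane}
    (hx : a • x = x) : b • x ≠ x := by
  intro hbx
  obtain ⟨ψ, rfl⟩ := exists_smul_infty x
  rw [← conj_smul_eq_self] at hx hbx
  have hmul : ∀ g h : MoebiusGroup, ψ⁻¹ * g * ψ * (ψ⁻¹ * h * ψ) = ψ⁻¹ * (g * h) * ψ := fun g h => by
    group
  have hcancel : ∀ g h : MoebiusGroup, ψ⁻¹ * g * ψ = ψ⁻¹ * h * ψ → g = h := fun g h e =>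
    mul_left_cancel (mul_right_cancel e)
  have hone : ψ⁻¹ * 1 * ψ = 1 := by group
  obtain ⟨d, hd⟩ := involution_affine (by rw [hmul, ha, hone])
    (fun h => ha1 (hcancel _ _ (h.trans hone.symm))) hx
  obtain ⟨d', hd'⟩ := involution_affine (by rw [hmul, hb, hone])
    (fun h => hb1 (hcancel _ _ (h.trans hone.symm))) hbx
  have hcomm : ψ⁻¹ * a * ψ * (ψ⁻¹ * b * ψ) = ψ⁻¹ * b * ψ * (ψ⁻¹ * a * ψ) := by
    rw [hmul, hmul, hab]
  have := congrArg (fun g : MoebiusGroup => g • ((0 : ℂ) : ExtPlane)) hcomm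
  simp only [mul_smul, hd, hd', OnePoint.coe_eq_coe] at this
  have hdd : d = d' := by linear_combination this / 2
  subst hdd
  exact hne (hcancel _ _ (moebius_eq_of_three (by rw [hd, hd']) (by rw [hd, hd'])
    (by rw [hx, hbx])))

theorem negMob_mul_dil {l : ℂ} (hl : l ≠ 0) : negMob * dil l hl = dil l hl * negMob := by
  rw [negMob, dil_mul_dil, dil_mul_dil]
  simp only [mul_comm]

theorem recip_mul_negMob : recip * negMob = negMob * recip := by
  rw [negMob, recip_mul_dil]
  congr 2
  norm_num

/-- Two distinct commuting involutions can be normalized simultaneously. -/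
theorem exists_conj_eq_std {a b : MoebiusGroup} (ha : a * a = 1) (hb : b * b = 1)
    (hab : a * b = b * a) (ha1 : a ≠ 1) (hb1 : b ≠ 1) (hne : a ≠ b) :
    ∃ ψ : MoebiusGroup, ψ⁻¹ * a * ψ = negMob ∧ ψ⁻¹ * b * ψ = recip := by
  obtain ⟨x, hx⟩ := exists_fixed_point a
  have hbx := smul_ne_of_fixed_of_commute ha hb hab ha1 hb1 hne hx
  -- The points `x` and `b • x` are both fixed by `a` and are exchanged by `b`. Placing them at `∞`
  -- and `0` turns `a` into a dilation and `b` into `1 / (m z)`.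
  obtain ⟨ψ, hψ1, hψ0⟩ := exists_smul_infty_smul_zero hbx.symm
  have ha0 : a • b • x = b • x := by rw [← mul_smul, hab, mul_smul, hx]
  have hbb : b • b • x = x := by rw [← mul_smul, hb, one_smul]
  obtain ⟨l, hl, hal⟩ : ∃ l hl, ψ⁻¹ * a * ψ = dil l hl :=
    exists_eq_dil (by rw [conj_smul_eq_self, hψ1, hx]) (by rw [conj_smul_eq_self, hψ0, ha0])
  obtain ⟨m, hm, hbm⟩ : ∃ m hm, recip * (ψ⁻¹ * b * ψ) = dil m hm := by
    apply exists_eq_dil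
    · rw [mul_smul, mul_smul, mul_smul, hψ1, ← hψ0, inv_smul_smul, recip_smul_zero]
    · rw [mul_smul, mul_smul, mul_smul, hψ0, hbb, ← hψ1, inv_smul_smul, recip_smul_infty]
  have hl1 : l = -1 := by
    have h2 : dil l hl * dil l hl = 1 := by
      rw [← hal, show ψ⁻¹ * a * ψ * (ψ⁻¹ * a * ψ) = ψ⁻¹ * (a * a) * ψ by group, ha]; group
    rw [dil_mul_dil, ← dil_one] at h2
    rcases mul_self_eq_one_iff.1 (dil_inj h2) with h | h
    · subst h
      rw [dil_one] at hal
      refine absurd ?_ ha1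
      rw [show a = ψ * (ψ⁻¹ * a * ψ) * ψ⁻¹ by group, hal]; group
    · exact h
  subst hl1
  -- Conjugation by `z ↦ r z` turns `1 / (m z)` into `1 / (m r² z)`, hence the choice `r² = m⁻¹`.
  obtain ⟨r, hr⟩ := IsAlgClosed.exists_pow_nat_eq m⁻¹ (n := 2) (by norm_num)
  have hr0 : r ≠ 0 := by
    rintro rfl
    rw [zero_pow two_ne_zero] at hr
    exact inv_ne_zero hm hr.symm
  have hbm' : ψ⁻¹ * b * ψ = recip * dil m hm := by
    rw [← hbm, ← mul_assoc, recip_mul_recip, one_mul]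
  refine ⟨ψ * dil r hr0, ?_, ?_⟩
  · rw [show (ψ * dil r hr0)⁻¹ * a * (ψ * dil r hr0)
      = (dil r hr0)⁻¹ * (ψ⁻¹ * a * ψ * dil r hr0) by group, hal]
    change (dil r hr0)⁻¹ * (negMob * dil r hr0) = negMob
    rw [negMob_mul_dil, inv_mul_cancel_left]
  · rw [show (ψ * dil r hr0)⁻¹ * b * (ψ * dil r hr0)
      = (dil r hr0)⁻¹ * (ψ⁻¹ * b * ψ * dil r hr0) by group, hbm', inv_mul_eq_iff_eq_mul, mul_assoc,
      dil_mul_dil, ← mul_left_cancel_iff (a := recip), ← mul_assoc, recip_mul_recip, one_mul,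
      ← mul_assoc, recip_mul_dil, mul_assoc, recip_mul_recip, mul_one]
    congr 1
    symm
    apply inv_eq_of_mul_eq_one_right
    rw [mul_left_comm, ← sq, hr, mul_inv_cancel₀ hm]

/-- The four-group is its own centralizer: `u` permutes the fixed points `∞`, `0` of `negMob`, and
up to `recip` it fixes both, so it is a dilation; commuting with `recip` makes its factor `±1`. -/
theorem eq_of_commute_std {u : MoebiusGroup} (ha : negMob * u = u * negMob)
    (hb : recip * u = u * recip) :
    u = 1 ∨ u = negMob ∨ u = recip ∨ u = recip * negMob := by
  have hfix : ∀ x : ExtPlane, negMob • x = x → x = ∞ ∨ x = ((0 : ℂ) : ExtPlane) := by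
    intro x hx
    induction x using OnePoint.rec with
    | infty => exact Or.inl rfl
    | coe z =>
      right
      rw [negMob, dil_smul_coe, OnePoint.coe_eq_coe] at hx
      rw [OnePoint.coe_eq_coe]
      linear_combination -hx / 2
  have key : ∀ w : MoebiusGroup, negMob * w = w * negMob → recip * w = w * recip →
      w • (∞ : ExtPlane) = ∞ → w = 1 ∨ w = negMob := by
    intro w hwa hwb hw
    have hw0 : w • ((0 : ℂ) : ExtPlane) = ((0 : ℂ) : ExtPlane) := by
      rw [← recip_smul_infty, ← mul_smul, ← hwb, mul_smul, hw]
    obtain ⟨l, hl, rfl⟩ := exists_eq_dil hw hw0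
    rw [recip_mul_dil, mul_left_inj] at hwb
    have hll : l * l = 1 := by
      nth_rw 1 [← dil_inj hwb]
      exact inv_mul_cancel₀ hl
    rcases mul_self_eq_one_iff.1 hll with rfl | rfl
    · exact Or.inl dil_one
    · exact Or.inr rfl
  have hu : u • (∞ : ExtPlane) = ∞ ∨ u • (∞ : ExtPlane) = ((0 : ℂ) : ExtPlane) := by
    apply hfix
    rw [← mul_smul, ha, mul_smul, negMob, dil_smul_infty]
  rcases hu with hu | hu
  · rcases key u ha hb hu with h | h
    exacts [Or.inl h, Or.inr (Or.inl h)]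
  · have h1 : negMob * (recip * u) = recip * u * negMob := by
      rw [← mul_assoc, ← recip_mul_negMob, mul_assoc, ha, mul_assoc]
    have h2 : recip * (recip * u) = recip * u * recip := by rw [mul_assoc, hb]
    have hr : ∀ w, recip * u = w → u = recip * w := by
      rintro _ rfl
      rw [← mul_assoc, recip_mul_recip, one_mul]
    rcases key _ h1 h2 (by rw [mul_smul, hu, recip_smul_zero]) with h | h
    · exact Or.inr (Or.inr (Or.inl (by rw [hr _ h, mul_one])))
    · exact Or.inr (Or.inr (Or.inr (hr _ h)))

/-- Every group of Möbius transformations isomorphic to `A₄` is conjugate to the standard one. -/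
theorem exists_conj_stdGroup {G : Subgroup MoebiusGroup}
    (hG : Nonempty (G ≃* alternatingGroup (Fin 4))) :
    ∃ ψ : MoebiusGroup, ∀ g, g ∈ G ↔ ψ⁻¹ * g * ψ ∈ stdGroup := by
  obtain ⟨ι⟩ := hG
  obtain ⟨ι₀, hA₀, hB₀, hC₀⟩ := exists_stdGroup_equiv
  obtain ⟨-, -, -, -, -, -, h7, h8, -⟩ :=
    exists_generators ι₀ negMob_mem recip_mem rot3_mem hA₀ hB₀ hC₀
  have hgen : ∀ σ ∈ alternatingGroup (Fin 4), ∃ g : MoebiusGroup, ∃ hg : g ∈ G,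
      (ι ⟨g, hg⟩ : Equiv.Perm (Fin 4)) = σ := fun σ hσ =>
    ⟨ι.symm ⟨σ, hσ⟩, (ι.symm ⟨σ, hσ⟩).2, by simp⟩
  obtain ⟨a, ha, hA⟩ := hgen permA (by rw [Equiv.Perm.mem_alternatingGroup]; decide)
  obtain ⟨b, hb, hB⟩ := hgen permB (by rw [Equiv.Perm.mem_alternatingGroup]; decide)
  obtain ⟨t, ht, hC⟩ := hgen permC (by rw [Equiv.Perm.mem_alternatingGroup]; decide)
  obtain ⟨g1, g2, g3, g4, g5, g6, g7, g8, g9⟩ := exists_generators ι ha hb ht hA hB hC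
  obtain ⟨ψ, hψa, hψb⟩ := exists_conj_eq_std g1 g2 g3 g4 g5 g6
  have hconj : ∀ g h : MoebiusGroup, ψ⁻¹ * (g * h) * ψ = ψ⁻¹ * g * ψ * (ψ⁻¹ * h * ψ) := fun g h => by
    group
  -- `t1` and `rot3` induce the same automorphism of the four-group, so `rot3⁻¹ * t1` centralizes it
  -- and belongs to it.
  obtain ⟨t1, ht1⟩ : ∃ t1, t1 = ψ⁻¹ * t * ψ := ⟨_, rfl⟩
  have k7 : t1 * recip = negMob * t1 := by rw [ht1, ← hψa, ← hψb, ← hconj, ← hconj, g7]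
  have k8 : t1 * negMob = negMob * recip * t1 := by
    rw [ht1, ← hψa, ← hψb, ← hconj, ← hconj, ← hconj, g8]
  have q7 : recip * rot3⁻¹ = rot3⁻¹ * negMob := by
    rw [eq_inv_mul_iff_mul_eq, ← mul_assoc, h7, mul_inv_cancel_right]
  have q8 : negMob * rot3⁻¹ = rot3⁻¹ * (negMob * recip) := by
    rw [eq_inv_mul_iff_mul_eq, ← mul_assoc, h8, mul_inv_cancel_right]
  have hu1 : recip * (rot3⁻¹ * t1) = rot3⁻¹ * t1 * recip := by
    rw [← mul_assoc, q7, mul_assoc, ← k7, mul_assoc]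
  have hu2 : negMob * (rot3⁻¹ * t1) = rot3⁻¹ * t1 * negMob := by
    rw [← mul_assoc, q8, mul_assoc, ← k8, mul_assoc]
  have hu := eq_of_commute_std hu2 hu1
  refine ⟨ψ, fun g => ⟨fun hg => ?_, fun hg => ?_⟩⟩
  · have humem : rot3⁻¹ * t1 ∈ stdGroup := by
      rcases hu with h | h | h | h <;> rw [h]
      exacts [one_mem _, negMob_mem, recip_mem, mul_mem recip_mem negMob_mem]
    have ht1mem : t1 ∈ stdGroup := by
      rw [← mul_inv_cancel_left rot3 t1]
      exact mul_mem rot3_mem humem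
    obtain ⟨i, j, k, rfl⟩ := g9 g hg
    have hcp : ∀ (g : MoebiusGroup) (n : ℕ), ψ⁻¹ * g ^ n * ψ = (ψ⁻¹ * g * ψ) ^ n := fun g n => by
      have := map_pow (MulAut.conj ψ⁻¹) g n
      simpa using this
    rw [hconj, hconj, hcp, hcp, hcp, hψa, hψb, ← ht1]
    exact mul_mem (mul_mem (pow_mem negMob_mem _) (pow_mem recip_mem _)) (pow_mem ht1mem _)
  · have hle : stdGroup ≤ G.comap (MulAut.conj ψ).toMonoidHom := by
      have hA' : negMob ∈ G.comap (MulAut.conj ψ).toMonoidHom := by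
        rw [← hψa]; simpa [mul_assoc] using ha
      have hB' : recip ∈ G.comap (MulAut.conj ψ).toMonoidHom := by
        rw [← hψb]; simpa [mul_assoc] using hb
      have hT' : t1 ∈ G.comap (MulAut.conj ψ).toMonoidHom := by
        rw [ht1]; simpa [mul_assoc] using ht
      have humem : rot3⁻¹ * t1 ∈ G.comap (MulAut.conj ψ).toMonoidHom := by
        rcases hu with h | h | h | h <;> rw [h]
        exacts [one_mem _, hA', hB', mul_mem hB' hA']
      rw [stdGroup, Subgroup.closure_le]
      rintro _ (rfl | rfl | rfl)
      · exact hA'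
      · exact hB'
      · have : rot3 = t1 * (rot3⁻¹ * t1)⁻¹ := by group
        rw [this]
        exact mul_mem hT' (inv_mem humem)
    have := hle hg
    rw [Subgroup.mem_comap] at this
    simpa [mul_assoc] using this

theorem exists_isTetrahedralTriple {G : Subgroup MoebiusGroup}
    (hG : Nonempty (G ≃* alternatingGroup (Fin 4))) : ∃ V F E, IsTetrahedralTriple G V F E := by
  obtain ⟨ψ, hψ⟩ := exists_conj_stdGroup hG
  exact ⟨_, _, _, ψ, stdSimplex3, isInscribedRegular_std,
    fun g hg => actsAsRotationOf_of_mem_stdGroup ((hψ g).1 hg), rfl, rfl, rfl⟩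

/-! ### A symmetry outside the group that normalizes it -/

/-- The rotation by `π/2` about the vertical axis, as the Möbius transformation `z ↦ i z`. -/
noncomputable def quarterTurn : MoebiusGroup := dil Complex.I Complex.I_ne_zero

theorem quarterTurn_sq : quarterTurn * quarterTurn = negMob := by
  rw [quarterTurn, dil_mul_dil]
  simp [negMob]

/-- Its square is `negMob`, which corresponds to a double transposition; the square roots of that in
S₄ are 4-cycles, which are odd. -/
theorem quarterTurn_not_mem : quarterTurn ∉ stdGroup := by
  intro h
  obtain ⟨ι, hA, -⟩ := exists_stdGroup_equiv
  have h2 : (⟨quarterTurn, h⟩ : stdGroup) * ⟨quarterTurn, h⟩ = ⟨negMob, negMob_mem⟩ :=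
    Subtype.ext quarterTurn_sq
  have h3 := congrArg (fun g => (ι g : Equiv.Perm (Fin 4))) h2
  simp only [map_mul, Subgroup.coe_mul, hA] at h3
  have hσ : ∀ σ : Equiv.Perm (Fin 4), Equiv.Perm.sign σ = 1 → σ * σ ≠ permA := by decide
  exact hσ _ (Equiv.Perm.mem_alternatingGroup.1 (ι ⟨quarterTurn, h⟩).2) h3

theorem rot3_negMob_quarterTurn_rot3 : rot3 * negMob * (quarterTurn * rot3) = quarterTurn := by
  have r0 : rot3 • ((0 : ℂ) : ExtPlane) = ((-Complex.I : ℂ) : ExtPlane) := by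
    rw [rot3, mob_smul_coe]; simp [div_neg]
  have r1 : rot3 • ((1 : ℂ) : ExtPlane) = ∞ := by rw [rot3, mob_smul_coe]; simp
  have r2 : rot3 • ((-1 : ℂ) : ExtPlane) = ((0 : ℂ) : ExtPlane) := by
    rw [rot3, mob_smul_coe, if_neg (by norm_num)]; simp
  have r3 : rot3 • (∞ : ExtPlane) = ((Complex.I : ℂ) : ExtPlane) := by
    rw [rot3, mob_smul_infty]; simp
  apply moebius_eq_of_three <;>
    simp [mul_smul, quarterTurn, negMob, dil_smul_coe, dil_smul_infty, r0, r1, r2, r3]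

theorem quarterTurn_conj_mem {g : MoebiusGroup} (hg : g ∈ stdGroup) :
    quarterTurn * g * quarterTurn⁻¹ ∈ stdGroup := by
  have hmem : ∀ x, x ∈ stdGroup.comap (MulAut.conj quarterTurn).toMonoidHom ↔
      quarterTurn * x * quarterTurn⁻¹ ∈ stdGroup := fun x => by simp [Subgroup.mem_comap]
  have hle : stdGroup ≤ stdGroup.comap (MulAut.conj quarterTurn).toMonoidHom := by
    refine (Subgroup.closure_le _).2 ?_
    rintro _ (rfl | rfl | rfl)
    · rw [SetLike.mem_coe, hmem]
      rw [quarterTurn, ← negMob_mul_dil, mul_inv_cancel_right]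
      exact negMob_mem
    · rw [SetLike.mem_coe, hmem]
      have : quarterTurn * recip * quarterTurn⁻¹ = recip * negMob := by
        rw [mul_inv_eq_iff_eq_mul, quarterTurn, negMob, mul_assoc, dil_mul_dil, recip_mul_dil]
        congr 2
        simp
      rw [this]
      exact mul_mem recip_mem negMob_mem
    · rw [SetLike.mem_coe, hmem]
      have : quarterTurn * rot3 * quarterTurn⁻¹ = (rot3 * negMob)⁻¹ := by
        rw [mul_inv_eq_iff_eq_mul, eq_inv_mul_iff_mul_eq, rot3_negMob_quarterTurn_rot3]
      rw [this]
      exact inv_mem (mul_mem rot3_mem negMob_mem)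
  exact (hmem g).1 (hle hg)

theorem exists_normalizing {G : Subgroup MoebiusGroup}
    (hG : Nonempty (G ≃* alternatingGroup (Fin 4))) :
    ∃ s ∉ G, ∀ g ∈ G, s * g * s⁻¹ ∈ G ∧ s⁻¹ * g * s ∈ G := by
  obtain ⟨ψ, hψ⟩ := exists_conj_stdGroup hG
  have hinv : quarterTurn⁻¹ = quarterTurn * negMob := by
    rw [inv_eq_iff_mul_eq_one, ← mul_assoc, quarterTurn_sq, negMob, dil_mul_dil, ← dil_one]
    simp
  refine ⟨ψ * quarterTurn * ψ⁻¹, fun h => quarterTurn_not_mem ?_, fun g hg => ⟨?_, ?_⟩⟩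
  · have := (hψ _).1 h
    rwa [show ψ⁻¹ * (ψ * quarterTurn * ψ⁻¹) * ψ = quarterTurn by group] at this
  · rw [hψ, show ψ⁻¹ * (ψ * quarterTurn * ψ⁻¹ * g * (ψ * quarterTurn * ψ⁻¹)⁻¹) * ψ
      = quarterTurn * (ψ⁻¹ * g * ψ) * quarterTurn⁻¹ by group]
    exact quarterTurn_conj_mem ((hψ g).1 hg)
  · rw [hψ, show ψ⁻¹ * ((ψ * quarterTurn * ψ⁻¹)⁻¹ * g * (ψ * quarterTurn * ψ⁻¹)) * ψ
      = quarterTurn⁻¹ * (ψ⁻¹ * g * ψ) * quarterTurn⁻¹⁻¹ by group, hinv,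
      show quarterTurn * negMob * (ψ⁻¹ * g * ψ) * (quarterTurn * negMob)⁻¹
      = quarterTurn * (negMob * (ψ⁻¹ * g * ψ) * negMob⁻¹) * quarterTurn⁻¹ by group]
    exact quarterTurn_conj_mem
      (mul_mem (mul_mem negMob_mem ((hψ g).1 hg)) (inv_mem negMob_mem))

/-! ### Algebraicity of finite groups containing the standard group -/

theorem mob_mul {a b c d a' b' c' d' : ℂ} (h : a * d - b * c ≠ 0) (h' : a' * d' - b' * c' ≠ 0) :
    mob a b c d h * mob a' b' c' d' h' = mob (a * a' + b * c') (a * b' + b * d')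
      (c * a' + d * c') (c * b' + d * d') (by
        convert mul_ne_zero h h' using 1; ring) := by
  apply Subtype.ext
  change MulAction.toPermHom (GL (Fin 2) ℂ) ExtPlane _ * MulAction.toPermHom (GL (Fin 2) ℂ) ExtPlane _
    = MulAction.toPermHom (GL (Fin 2) ℂ) ExtPlane _
  rw [← map_mul]
  congr 1
  ext i j
  fin_cases i <;> fin_cases j <;>
    simp [Matrix.GeneralLinearGroup.mkOfDetNeZero, Matrix.mul_apply, Fin.sum_univ_two]

theorem mob_scale {a b c d r : ℂ} (h : a * d - b * c ≠ 0) (hr : r ≠ 0) :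
    mob a b c d h = mob (r * a) (r * b) (r * c) (r * d) (by
      convert mul_ne_zero (mul_ne_zero hr hr) h using 1; ring) := by
  apply moebius_ext
  intro x
  induction x using OnePoint.rec with
  | infty => simp [mob_smul_infty, hr, mul_div_mul_left]
  | coe z =>
    rw [mob_smul_coe, mob_smul_coe]
    have e1 : r * c * z + r * d = r * (c * z + d) := by ring
    have e2 : r * a * z + r * b = r * (a * z + b) := by ring
    rw [e1, e2, mul_div_mul_left _ _ hr]
    simp [hr]

theorem exists_eq_mob_det_one (g : MoebiusGroup) :
    ∃ a b c d : ℂ, ∃ h : a * d - b * c ≠ 0, a * d - b * c = 1 ∧ g = mob a b c d h := by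
  obtain ⟨a, b, c, d, h, rfl⟩ := exists_eq_mob g
  obtain ⟨r, hr⟩ := IsAlgClosed.exists_pow_nat_eq (a * d - b * c)⁻¹ (n := 2) (by norm_num)
  have hr0 : r ≠ 0 := by
    rintro rfl
    rw [zero_pow two_ne_zero] at hr
    exact inv_ne_zero h hr.symm
  refine ⟨_, _, _, _, _, ?_, mob_scale h hr0⟩
  have : r * a * (r * d) - r * b * (r * c) = r ^ 2 * (a * d - b * c) := by ring
  rw [this, hr, inv_mul_cancel₀ h]

/-- A unimodular matrix that represents a transformation of finite order has an algebraic trace. -/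
theorem isAlgebraic_trace {a b c d : ℂ} {h : a * d - b * c ≠ 0} (hdet : a * d - b * c = 1) {n : ℕ}
    (hn : 0 < n) (hpow : mob a b c d h ^ n = 1) : IsAlgebraic ℚ (a + d) := by
  set M : GL (Fin 2) ℂ := Matrix.GeneralLinearGroup.mkOfDetNeZero !![a, b; c, d]
    (by simpa [Matrix.det_fin_two] using h) with hM
  have hMn : ∀ x : ExtPlane, (M ^ n) • x = x := by
    intro x
    have h1 := congrArg (fun g : MoebiusGroup => (g : Equiv.Perm ExtPlane)) hpow
    have h2 : MulAction.toPermHom (GL (Fin 2) ℂ) ExtPlane (M ^ n) = 1 := by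
      rw [map_pow]
      exact h1
    exact congrArg (fun g : Equiv.Perm ExtPlane => g x) h2
  have h10 : (M ^ n) 1 0 = 0 := OnePoint.smul_infty_eq_self_iff.1 (hMn ∞)
  have hz : ∀ z : ℂ, (M ^ n) 0 0 * z + (M ^ n) 0 1 = z * (M ^ n) 1 1 := by
    intro z
    have hd : (M ^ n) 1 1 ≠ 0 := by
      intro h0
      apply (M ^ n).det_ne_zero
      rw [Matrix.det_fin_two, h0, h10]
      ring
    have := hMn z
    rw [OnePoint.smul_some_eq_ite, h10, zero_mul, zero_add, if_neg hd, OnePoint.coe_eq_coe,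
      div_eq_iff hd] at this
    exact this
  have h01 : (M ^ n) 0 1 = 0 := by simpa using hz 0
  have h00 : (M ^ n) 0 0 = (M ^ n) 1 1 := by simpa [h01] using hz 1
  have hMdet : (M : Matrix (Fin 2) (Fin 2) ℂ).det = 1 := by
    rw [hM]
    simpa [Matrix.GeneralLinearGroup.mkOfDetNeZero, Matrix.det_fin_two] using hdet
  -- `M ^ n` acts trivially, so it is scalar, and determinant one makes the scalar `±1`. An
  -- eigenvalue `l` of `M` is then a root of unity, and the trace is `l + l⁻¹`.
  have hsq : (M ^ n) 1 1 * (M ^ n) 1 1 = 1 := by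
    have h1 : ((M ^ n : GL (Fin 2) ℂ) : Matrix (Fin 2) (Fin 2) ℂ).det = 1 := by
      rw [Units.val_pow_eq_pow_val, Matrix.det_pow, hMdet, one_pow]
    rw [Matrix.det_fin_two, h10, h00] at h1
    simpa using h1
  obtain ⟨s, hs⟩ := IsAlgClosed.exists_pow_nat_eq (discrim 1 (-(a + d)) 1) (n := 2) (by norm_num)
  have hl := (quadratic_eq_zero_iff one_ne_zero (by rw [← hs, sq]) ((-(-(a + d)) + s) / (2 * 1))).2
    (Or.inl rfl)
  generalize (-(-(a + d)) + s) / (2 * 1) = l at hl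
  have hl0 : l ≠ 0 := by rintro rfl; simp at hl
  obtain ⟨w, hw0, hw⟩ := Matrix.exists_mulVec_eq_zero_iff.2
    (show (!![a - l, b; c, d - l] : Matrix (Fin 2) (Fin 2) ℂ).det = 0 by
      rw [Matrix.det_fin_two_of]; linear_combination hdet + hl)
  have hMw : (M : Matrix (Fin 2) (Fin 2) ℂ).mulVec w = l • w := by
    have e0 := congrFun hw 0
    have e1 := congrFun hw 1
    simp at e0 e1
    change (a - l) * w 0 + b * w 1 = 0 at e0
    change c * w 0 + (d - l) * w 1 = 0 at e1
    funext i
    fin_cases i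
    · simp [hM, Matrix.GeneralLinearGroup.mkOfDetNeZero]
      change _ * w 0 + _ * w 1 = l * w 0
      linear_combination e0
    · simp [hM, Matrix.GeneralLinearGroup.mkOfDetNeZero]
      change _ * w 0 + _ * w 1 = l * w 1
      linear_combination e1
  have hpw : ∀ m : ℕ, ((M : Matrix (Fin 2) (Fin 2) ℂ) ^ m).mulVec w = l ^ m • w := by
    intro m
    induction m with
    | zero => simp
    | succ m ih =>
      rw [pow_succ, ← Matrix.mulVec_mulVec, hMw, Matrix.mulVec_smul, ih, smul_smul, pow_succ']
  have hln : l ^ n = (M ^ n) 1 1 := by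
    have h1 := hpw n
    obtain ⟨i, hi⟩ := Function.ne_iff.1 hw0
    rw [← Units.val_pow_eq_pow_val] at h1
    rw [Matrix.mulVec_fin_two, h10, h01, h00] at h1
    have e0 : l ^ n * w 0 = (M ^ n) 1 1 * w 0 := by
      have := congrFun h1 0
      simp only [Matrix.cons_val_zero, Pi.smul_apply, smul_eq_mul] at this
      rw [← this]; ring
    have e1 : l ^ n * w 1 = (M ^ n) 1 1 * w 1 := by
      have := congrFun h1 1
      simp only [Matrix.cons_val_one, Matrix.cons_val_fin_one, Pi.smul_apply, smul_eq_mul] at this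
      rw [← this]; ring
    apply mul_right_cancel₀ hi
    fin_cases i
    exacts [e0, e1]
  have hl1 : l ^ (n * 2) = 1 := by rw [pow_mul, hln, sq, hsq]
  have hlalg : IsAlgebraic ℚ l := by
    apply IsIntegral.isAlgebraic
    exact IsIntegral.of_pow (n := n * 2) (by omega) (by rw [hl1]; exact isIntegral_one)
  have ht : a + d = l + l⁻¹ := by
    field_simp
    linear_combination -hl
  rw [ht]
  exact hlalg.add hlalg.inv

/-- The transformations with algebraic coefficients. -/
def algebraicMoebius : Set MoebiusGroup :=
  {g | ∃ a b c d : ℂ, ∃ h : a * d - b * c ≠ 0, IsAlgebraic ℚ a ∧ IsAlgebraic ℚ b ∧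
    IsAlgebraic ℚ c ∧ IsAlgebraic ℚ d ∧ g = mob a b c d h}

theorem countable_algebraicMoebius : algebraicMoebius.Countable := by
  classical
  have hK : {x : ℂ | IsAlgebraic ℚ x}.Countable := Algebraic.countable ℚ ℂ
  refine ((hK.prod (hK.prod (hK.prod hK))).image fun p : ℂ × ℂ × ℂ × ℂ =>
    if h : p.1 * p.2.2.2 - p.2.1 * p.2.2.1 ≠ 0 then mob p.1 p.2.1 p.2.2.1 p.2.2.2 h else 1).mono ?_
  rintro _ ⟨a, b, c, d, h, ha, hb, hc, hd, rfl⟩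
  exact ⟨(a, b, c, d), ⟨ha, hb, hc, hd⟩, dif_pos h⟩

/-- For unimodular `g`, the products of `g` with `1` and the unimodular lifts of the four-group all
have finite order as transformations. Their traces `a + d`, `i (a - d)`, `i (b + c)`, `b - c` are
therefore algebraic, and they determine the four entries. -/
theorem mem_algebraicMoebius {H : Subgroup MoebiusGroup} [Finite H] (hH : stdGroup ≤ H)
    {g : MoebiusGroup} (hg : g ∈ H) : g ∈ algebraicMoebius := by
  obtain ⟨a, b, c, d, h, hdet, rfl⟩ := exists_eq_mob_det_one g
  have hI : IsAlgebraic ℚ Complex.I :=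
    (IsIntegral.of_pow (n := 4) (by norm_num)
      (by rw [Complex.I_pow_four]; exact isIntegral_one)).isAlgebraic
  have halg : ∀ {a b c d : ℂ} {h : a * d - b * c ≠ 0}, a * d - b * c = 1 → mob a b c d h ∈ H →
      IsAlgebraic ℚ (a + d) := by
    intro a b c d h hdet hm
    obtain ⟨n, hn, hp⟩ := isOfFinOrder_iff_pow_eq_one.1 (isOfFinOrder_of_finite (⟨_, hm⟩ : H))
    exact isAlgebraic_trace (h := h) hdet hn (congrArg Subtype.val hp)
  have hII := Complex.I_mul_I
  have i1 : mob Complex.I 0 0 (-Complex.I) (by simp) ∈ H := by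
    apply hH
    have : negMob = mob Complex.I 0 0 (-Complex.I) (by simp) := by
      rw [negMob, dil, mob_scale (r := -Complex.I) _ (by simp)]
      simp only [mul_neg, mul_one, neg_neg, mul_zero]
    exact this ▸ negMob_mem
  have i2 : mob 0 Complex.I Complex.I 0 (by simp) ∈ H := by
    apply hH
    have : recip = mob 0 Complex.I Complex.I 0 (by simp) := by
      rw [recip, mob_scale (r := Complex.I) _ (by simp)]
      simp only [mul_one, mul_zero]
    exact this ▸ recip_mem
  have m1 := mul_mem hg i1
  have m2 := mul_mem hg i2
  have m3 := mul_mem m1 i2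
  rw [mob_mul] at m1 m2 m3
  rw [mob_mul] at m3
  have t0 := halg hdet hg
  have t1 := halg (by linear_combination (-Complex.I ^ 2) * hdet - hII) m1
  have t2 := halg (by linear_combination (-Complex.I ^ 2) * hdet - hII) m2
  have t3 := halg (by
    linear_combination Complex.I ^ 4 * hdet + (Complex.I ^ 2 - 1) * hII) m3
  have h2 : IsAlgebraic ℚ (2 : ℂ)⁻¹ := (isAlgebraic_algebraMap (2 : ℚ)).inv
  refine ⟨a, b, c, d, h, ?_, ?_, ?_, ?_, rfl⟩
  · have : a = 2⁻¹ * ((a + d) - Complex.I * (a * Complex.I + b * 0 + (c * 0 + d * -Complex.I))) := by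
      linear_combination ((a - d) / 2) * hII
    rw [this]
    exact h2.mul (t0.sub (hI.mul t1))
  · have : b = 2⁻¹ * (((a * Complex.I + b * 0) * 0 + (a * 0 + b * -Complex.I) * Complex.I +
        ((c * Complex.I + d * 0) * Complex.I + (c * 0 + d * -Complex.I) * 0))
        - Complex.I * (a * 0 + b * Complex.I + (c * Complex.I + d * 0))) := by
      linear_combination b * hII
    rw [this]
    exact h2.mul (t3.sub (hI.mul t2))
  · have : c = 2⁻¹ * (-(Complex.I * (a * 0 + b * Complex.I + (c * Complex.I + d * 0)))
        - ((a * Complex.I + b * 0) * 0 + (a * 0 + b * -Complex.I) * Complex.I +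
        ((c * Complex.I + d * 0) * Complex.I + (c * 0 + d * -Complex.I) * 0))) := by
      linear_combination c * hII
    rw [this]
    exact h2.mul ((hI.mul t2).neg.sub t3)
  · have : d = 2⁻¹ * ((a + d) + Complex.I * (a * Complex.I + b * 0 + (c * 0 + d * -Complex.I))) := by
      linear_combination (-(a - d) / 2) * hII
    rw [this]
    exact h2.mul (t0.add (hI.mul t1))

/-! ### Generic points by countability -/

theorem finite_fixed {g : MoebiusGroup} (hg : g ≠ 1) : {x : ExtPlane | g • x = x}.Finite := by
  classical
  by_contra hinf
  obtain ⟨t, ht, hcard⟩ := Set.Infinite.exists_subset_card_eq hinf 3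
  obtain ⟨x, y, z, hxy, hxz, hyz, rfl⟩ := Finset.card_eq_three.1 hcard
  exact hg (eq_one_of_three_fixed hxy hxz hyz (ht (by simp)) (ht (by simp)) (ht (by simp)))

theorem countable_fixed {C : Set MoebiusGroup} (hC : C.Countable) :
    {x : ExtPlane | ∃ g ∈ C, g ≠ 1 ∧ g • x = x}.Countable := by
  refine (hC.biUnion (t := fun g _ => {x : ExtPlane | g ≠ 1 ∧ g • x = x}) fun g _ => ?_).mono ?_
  · by_cases hg : g = 1
    · simp [hg]
    · exact ((finite_fixed hg).subset fun x hx => hx.2).countable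
  · rintro x ⟨g, hg, hx⟩
    exact Set.mem_biUnion hg hx

theorem not_countable_extPlane : ¬ (Set.univ : Set ExtPlane).Countable := by
  intro h
  apply not_countable_complex
  have := h.preimage (f := fun z : ℂ => (z : ExtPlane)) OnePoint.coe_injective
  simpa using this

theorem exists_notMem_of_countable {Q : Set ExtPlane} (hQ : Q.Countable) : ∃ x, x ∉ Q := by
  by_contra! h
  exact not_countable_extPlane (hQ.mono fun x _ => h x)

/-- Finitely many finite orbits together with `Q` would cover the uncountable plane by a countable
set. -/
theorem infinite_orbits {G : Subgroup MoebiusGroup} [Finite G] {Q : Set ExtPlane}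
    (hQ : Q.Countable) : {O : Set ExtPlane | ∃ x ∉ Q, O = MulAction.orbit G x}.Infinite := by
  intro hfin
  have hc : (⋃₀ {O : Set ExtPlane | ∃ x ∉ Q, O = MulAction.orbit G x}).Countable := by
    apply hfin.countable.sUnion
    rintro _ ⟨x, -, rfl⟩
    exact (Set.finite_range _).countable
  obtain ⟨x, hx⟩ := exists_notMem_of_countable (hQ.union hc)
  exact hx (Or.inr ⟨_, ⟨x, fun h => hx (Or.inl h), rfl⟩, MulAction.mem_orbit_self x⟩)

/-! ### Prescribing and excluding indices -/

section Index

variable {G : Subgroup MoebiusGroup} {V F E : Set ExtPlane}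

theorem IsOrbitTriple.disjoint_orbitsB (h : IsOrbitTriple G V F E) {O : Set ExtPlane}
    (hO : O ∈ ({V, F, E} : Set (Set ExtPlane))) : O ∉ orbitsB G V F E := by
  intro hB
  have := h.ncard_B O hB
  rcases hO with rfl | rfl | rfl
  · rw [h.ncard_V] at this; omega
  · rw [h.ncard_F] at this; omega
  · rw [h.ncard_E] at this; omega

theorem hasTetrahedralIndex_sUnion (hG : Nonempty (G ≃* alternatingGroup (Fin 4)))
    (ht : IsTetrahedralTriple G V F E) {𝒮 ℬ : Set (Set ExtPlane)} (hS : 𝒮 ⊆ {V, F, E})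
    (hB : ℬ ⊆ orbitsB G V F E) (hfin : ℬ.Finite) :
    HasTetrahedralIndex G (⋃₀ (𝒮 ∪ ℬ)) (𝒮 ∩ {V, F}).ncard (𝒮 ∩ {E}).ncard ℬ.ncard := by
  have h := ht.isOrbitTriple hG
  have hBne : ∀ O ∈ ℬ, O ∉ ({V, F, E} : Set (Set ExtPlane)) := fun O hO hO' =>
    h.disjoint_orbitsB hO' (hB hO)
  refine ⟨hG, V, F, E, ht, 𝒮 ∪ ℬ, ((Set.toFinite _).subset hS).union hfin,
    Set.union_subset_union hS hB, rfl, ?_, ?_, ?_⟩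
  · congr 1
    ext O
    constructor
    · rintro ⟨hO | hO, hO'⟩
      · exact ⟨hO, hO'⟩
      · exact absurd (by rcases hO' with rfl | rfl <;> simp) (hBne O hO)
    · rintro ⟨hO, hO'⟩
      exact ⟨Or.inl hO, hO'⟩
  · congr 1
    ext O
    constructor
    · rintro ⟨hO | hO, hO'⟩
      · exact ⟨hO, hO'⟩
      · exact absurd (by rcases hO' with rfl; simp) (hBne O hO)
    · rintro ⟨hO, hO'⟩
      exact ⟨Or.inl hO, hO'⟩
  · congr 1
    ext O
    constructor
    · rintro ⟨hO | hO, hO'⟩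
      · exact absurd hO' (h.disjoint_orbitsB (hS hO))
      · exact hO
    · intro hO
      exact ⟨Or.inr hO, hB hO⟩

theorem IsOrbitTriple.smul_mem_sUnion (h : IsOrbitTriple G V F E) {𝒪 : Set (Set ExtPlane)}
    (hO : 𝒪 ⊆ {V, F, E} ∪ orbitsB G V F E) {g : MoebiusGroup} (hg : g ∈ G) {x : ExtPlane}
    (hx : x ∈ ⋃₀ 𝒪) : g • x ∈ ⋃₀ 𝒪 := by
  obtain ⟨O, hOm, hxO⟩ := hx
  refine ⟨O, hOm, ?_⟩
  rw [← (h.exists_orbit_eq (hO hOm)).2 x hxO]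
  exact ⟨⟨g, hg⟩, rfl⟩

theorem IsOrbitTriple.finite_sUnion (h : IsOrbitTriple G V F E) {𝒪 : Set (Set ExtPlane)}
    (hO : 𝒪 ⊆ {V, F, E} ∪ orbitsB G V F E) (hfin : 𝒪.Finite) : (⋃₀ 𝒪).Finite := by
  apply hfin.sUnion
  intro O hm
  apply Set.finite_of_ncard_ne_zero
  rcases hO hm with (rfl | rfl | rfl) | hB
  · rw [h.ncard_V]; norm_num
  · rw [h.ncard_F]; norm_num
  · rw [h.ncard_E]; norm_num
  · rw [h.ncard_B O hB]; norm_num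

theorem IsOrbitTriple.exists_subset (h : IsOrbitTriple G V F E) {ν ε : ℕ} (hν : ν ≤ 2)
    (hε : ε ≤ 1) : ∃ 𝒮 : Set (Set ExtPlane), 𝒮 ⊆ {V, F, E} ∧ (𝒮 ∩ {V, F}).ncard = ν ∧
      (𝒮 ∩ {E}).ncard = ε := by
  obtain ⟨𝒱, h𝒱, rfl⟩ := Set.exists_subset_card_eq (s := ({V, F} : Set (Set ExtPlane))) (n := ν)
    (by rwa [Set.ncard_pair h.V_ne_F])
  obtain ⟨ℰ, hℰ, rfl⟩ := Set.exists_subset_card_eq (s := ({E} : Set (Set ExtPlane))) (n := ε)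
    (by rwa [Set.ncard_singleton])
  have hVE : V ≠ E := fun hh => by
    have := h.ncard_V
    rw [hh, h.ncard_E] at this
    omega
  have hFE : F ≠ E := fun hh => by
    have := h.ncard_F
    rw [hh, h.ncard_E] at this
    omega
  have hdisj : ∀ O, O ∈ ({V, F} : Set (Set ExtPlane)) → O ∈ ({E} : Set (Set ExtPlane)) → False := by
    rintro O (rfl | rfl) h2
    exacts [hVE h2, hFE h2]
  refine ⟨𝒱 ∪ ℰ, ?_, ?_, ?_⟩
  · rintro O (hO | hO)
    · rcases h𝒱 hO with rfl | rfl <;> simp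
    · rcases hℰ hO with rfl; simp
  · congr 1
    ext O
    exact ⟨fun ⟨h1, h2⟩ => h1.resolve_right fun h3 => hdisj O h2 (hℰ h3),
      fun h1 => ⟨Or.inl h1, h𝒱 h1⟩⟩
  · congr 1
    ext O
    exact ⟨fun ⟨h1, h2⟩ => h1.resolve_left fun h3 => hdisj O (h𝒱 h3) h2,
      fun h1 => ⟨Or.inr h1, hℰ h1⟩⟩

theorem ncard_orbit_smul {s : MoebiusGroup} (hs : ∀ g ∈ G, s * g * s⁻¹ ∈ G ∧ s⁻¹ * g * s ∈ G)
    (x : ExtPlane) : (MulAction.orbit G (s • x)).ncard = (MulAction.orbit G x).ncard := by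
  have : MulAction.orbit G (s • x) = s • MulAction.orbit G x := by
    ext y
    constructor
    · rintro ⟨g, rfl⟩
      refine ⟨(s⁻¹ * g * s) • x, ⟨⟨_, (hs g g.2).2⟩, rfl⟩, ?_⟩
      change s • (s⁻¹ * (g : MoebiusGroup) * s) • x = (g : MoebiusGroup) • s • x
      simp only [mul_smul, smul_inv_smul]
    · rintro ⟨_, ⟨g, rfl⟩, rfl⟩
      refine ⟨⟨_, (hs g g.2).1⟩, ?_⟩
      change (s * (g : MoebiusGroup) * s⁻¹) • s • x = s • (g : MoebiusGroup) • x
      simp only [mul_smul, inv_smul_smul]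
  rw [this, Set.ncard_smul_set]

/-- A union of non-generic orbits that contains both or none of `V` and `F` has further
symmetries. -/
theorem HasTetrahedralIndex.ne_stab {α : Set ExtPlane} (hα : HasStabilizerA4 α) {ν ε : ℕ}
    (h : HasTetrahedralIndex (stab α) α ν ε 0) : ν ≠ 0 ∧ ν ≠ 2 := by
  obtain ⟨s, hsG, hs⟩ := exists_normalizing hα.2
  obtain ⟨hG, V, F, E, ht, 𝒪, hfin, hO, hα', hν, -, hk⟩ := h
  have ho := ht.isOrbitTriple hG
  rw [← not_or]
  intro hν'
  apply hsG
  apply mem_stab_of_forall hα.1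
  intro x hx
  have hx0 := hx
  rw [← hα'] at hx0
  obtain ⟨O, hm, hxO⟩ := hx0
  have horb := (ho.exists_orbit_eq (hO hm)).2 x hxO
  have hk0 : 𝒪 ∩ orbitsB (stab α) V F E = ∅ := by
    rwa [Set.ncard_eq_zero (hfin.inter_of_left _)] at hk
  have hmem : ∀ P ∈ 𝒪, ∀ y ∈ P, y ∈ α := fun P hP y hy => hα' ▸ ⟨P, hP, hy⟩
  have hself := MulAction.mem_orbit_self (M := stab α) (s • x)
  have hcard := ncard_orbit_smul hs x
  rw [horb] at hcard
  have hsx := ho.orbit_mem (s • x)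
  have hsmall : O ∈ ({V, F, E} : Set (Set ExtPlane)) := by
    refine (hO hm).resolve_right fun hB => ?_
    have : O ∈ 𝒪 ∩ orbitsB (stab α) V F E := ⟨hm, hB⟩
    rw [hk0] at this
    exact this
  -- A 4-point orbit in `α` excludes `ν = 0`, so `ν = 2` and both `V` and `F` lie in `α`; it does
  -- not matter whether `s` exchanges them.
  have hVF : O ∈ ({V, F} : Set (Set ExtPlane)) → {V, F} ⊆ 𝒪 := by
    intro h1
    have h2 : ν = 2 := by
      refine hν'.resolve_left fun h0 => ?_
      rw [h0, Set.ncard_eq_zero (hfin.inter_of_left _)] at hν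
      have : O ∈ 𝒪 ∩ {V, F} := ⟨hm, h1⟩
      rw [hν] at this
      exact this
    rw [← Set.inter_eq_right]
    exact Set.eq_of_subset_of_ncard_le Set.inter_subset_right
      (by rw [hν, h2, Set.ncard_pair ho.V_ne_F])
  have h4 : O ∈ ({V, F} : Set (Set ExtPlane)) → O.ncard = 4 := by
    rintro (rfl | rfl)
    exacts [ho.ncard_V, ho.ncard_F]
  have hcases : O ∈ ({V, F} : Set (Set ExtPlane)) ∨ O = E := by
    rcases hsmall with rfl | rfl | rfl <;> simp
  rcases hcases with h1 | rfl
  · rw [h4 h1] at hcard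
    rcases hsx with (h | h | h) | h
    · exact hmem V (hVF h1 (by simp)) _ (h ▸ hself)
    · exact hmem F (hVF h1 (by simp)) _ (h ▸ hself)
    · rw [h, ho.ncard_E] at hcard; omega
    · rw [ho.ncard_B _ h] at hcard; omega
  · rw [ho.ncard_E] at hcard
    rcases hsx with (h | h | h) | h
    · rw [h, ho.ncard_V] at hcard; omega
    · rw [h, ho.ncard_F] at hcard; omega
    · exact hmem O hm _ (h ▸ hself)
    · rw [ho.ncard_B _ h] at hcard; omega

end Index

/-! ### Sets realizing the remaining indices -/

theorem exists_alpha_of_pos {ν ε k : ℕ} (hν : ν ≤ 2) (hε : ε ≤ 1) (hk : 1 ≤ k) :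
    ∃ α : Set ExtPlane, HasStabilizerA4 α ∧ HasTetrahedralIndex (stab α) α ν ε k := by
  have hG := stdGroup_equiv
  have hGfin : Finite stdGroup := Nat.finite_of_card_ne_zero (by rw [card_eq_twelve hG]; norm_num)
  obtain ⟨V, F, E, ht⟩ := exists_isTetrahedralTriple hG
  have h := ht.isOrbitTriple hG
  obtain ⟨𝒮, hS, rfl, rfl⟩ := h.exists_subset hν hε
  have hGC : ∀ g ∈ stdGroup, g ∈ algebraicMoebius := fun g hg => mem_algebraicMoebius le_rfl hg
  set Q := {x : ExtPlane | ∃ g ∈ algebraicMoebius, g ≠ 1 ∧ g • x = x} with hQdef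
  have hQ : Q.Countable := countable_fixed countable_algebraicMoebius
  obtain ⟨X, hX⟩ := exists_notMem_of_countable hQ
  -- The other generic orbits must avoid every algebraic translate of `X`, so that no element of
  -- `stab α` can carry `X` into them. Only `k - 1` of them are needed, the orbit of `X` being the
  -- remaining one.
  have hQ' : (Q ∪ (fun g : MoebiusGroup => g • X) '' algebraicMoebius).Countable :=
    hQ.union (countable_algebraicMoebius.image _)
  obtain ⟨t, htsub, htcard⟩ :=
    Set.Infinite.exists_subset_card_eq (infinite_orbits (G := stdGroup) hQ') (k - 1)
  have hnotQ : ∀ x ∉ Q, x ∉ V ∪ F ∪ E := by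
    intro x hx hx'
    obtain ⟨g, hg, hg1, hgx⟩ := h.fixed x hx'
    exact hx ⟨g, hGC g hg, hg1, hgx⟩
  set ℬ : Set (Set ExtPlane) := insert (MulAction.orbit stdGroup X) (t : Set (Set ExtPlane)) with hℬ
  have hB : ℬ ⊆ orbitsB stdGroup V F E := by
    rintro O (rfl | hO)
    · exact ⟨X, hnotQ X hX, rfl⟩
    · obtain ⟨x, hx, rfl⟩ := htsub hO
      exact ⟨x, hnotQ x fun hxQ => hx (Or.inl hxQ), rfl⟩
  have hXt : MulAction.orbit stdGroup X ∉ (t : Set (Set ExtPlane)) := by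
    intro hmem
    obtain ⟨x, hx, hxX⟩ := htsub hmem
    have : x ∈ MulAction.orbit stdGroup X := hxX ▸ MulAction.mem_orbit_self x
    obtain ⟨g, rfl⟩ := this
    exact hx (Or.inr ⟨g, hGC g g.2, rfl⟩)
  have hBcard : ℬ.ncard = k := by
    rw [hℬ, Set.ncard_insert_of_notMem hXt t.finite_toSet, Set.ncard_coe_finset, htcard]
    omega
  have hBfin : ℬ.Finite := t.finite_toSet.insert _
  have hO : 𝒮 ∪ ℬ ⊆ {V, F, E} ∪ orbitsB stdGroup V F E := Set.union_subset_union hS hB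
  have hindex := hasTetrahedralIndex_sUnion hG ht hS hB hBfin
  rw [hBcard] at hindex
  set α := ⋃₀ (𝒮 ∪ ℬ) with hα
  have hαfin : α.Finite :=
    h.finite_sUnion hO (((Set.toFinite _).subset hS).union hBfin)
  have hle : stdGroup ≤ stab α := fun g hg =>
    mem_stab_of_forall hαfin fun x hx => h.smul_mem_sUnion hO hg hx
  have hXorb : MulAction.orbit stdGroup X ⊆ α := fun x hx => ⟨_, Or.inr (Or.inl rfl), hx⟩
  have hfin : Finite (stab α) := by
    apply finite_stab hαfin
    refine lt_of_lt_of_le ?_ (Set.ncard_le_ncard hXorb hαfin)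
    rw [h.ncard_B _ ⟨X, hnotQ X hX, rfl⟩]
    norm_num
  have hHC : ∀ g ∈ stab α, g ∈ algebraicMoebius := fun g hg => mem_algebraicMoebius hle hg
  have hst : stab α = stdGroup := by
    refine le_antisymm (fun g hg => ?_) hle
    have hfree : ∀ u ∈ stab α, u • X = X → u = 1 := fun u hu huX => by
      by_contra hu1
      exact hX ⟨u, hHC u hu, hu1, huX⟩
    obtain ⟨O, hOm, hgX⟩ := smul_mem_of_mem_stab hg (hXorb (MulAction.mem_orbit_self X))
    -- A point of `V ∪ F ∪ E` has a nontrivial stabilizer in `stdGroup`; conjugated by `g` it would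
    -- fix `X`, on which `stab α` acts freely.
    have hsmall : g • X ∉ V ∪ F ∪ E := by
      intro hmem
      obtain ⟨u, hu, hu1, hux⟩ := h.fixed _ hmem
      have := hfree (g⁻¹ * u * g) (mul_mem (mul_mem (inv_mem hg) (hle hu)) hg)
        (by rw [conj_smul_eq_self, hux])
      apply hu1
      rw [show u = g * (g⁻¹ * u * g) * g⁻¹ by group, this]
      group
    rcases hOm with hOm | rfl | hOm
    · refine absurd ?_ hsmall
      rcases hS hOm with rfl | rfl | rfl
      exacts [Or.inl (Or.inl hgX), Or.inl (Or.inr hgX), Or.inr hgX]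
    -- The surviving case: `g` agrees at `X` with some `u` in `stdGroup`, and freeness at `X` gives
    -- `g = u`.
    · obtain ⟨u, hu⟩ := hgX
      have hu' : (u : MoebiusGroup) • X = g • X := hu
      have := hfree ((u : MoebiusGroup)⁻¹ * g) (mul_mem (inv_mem (hle u.2)) hg)
        (by rw [mul_smul, inv_smul_eq_iff, hu'])
      rw [inv_mul_eq_one] at this
      exact this ▸ u.2
    · obtain ⟨x, hx, rfl⟩ := htsub hOm
      obtain ⟨u, hu⟩ := hgX
      have hu' : (u : MoebiusGroup) • x = g • X := hu
      refine absurd (Or.inr ⟨(u : MoebiusGroup)⁻¹ * g,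
        hHC _ (mul_mem (inv_mem (hle u.2)) hg), ?_⟩) hx
      change ((u : MoebiusGroup)⁻¹ * g) • X = x
      rw [mul_smul, inv_smul_eq_iff, hu']
  exact ⟨α, ⟨hαfin, by rw [hst]; exact hG⟩, by rw [hst]; exact hindex⟩

theorem exists_alpha_one {ε : ℕ} (hε : ε ≤ 1) :
    ∃ α : Set ExtPlane, HasStabilizerA4 α ∧ HasTetrahedralIndex (stab α) α 1 ε 0 := by
  have hG := stdGroup_equiv
  obtain ⟨V, F, E, ht⟩ := exists_isTetrahedralTriple hG
  have h := ht.isOrbitTriple hG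
  have key : ∀ 𝒮 : Set (Set ExtPlane), 𝒮 ⊆ {V, F, E} → stab (⋃₀ 𝒮) ≤ stdGroup →
      ∃ α : Set ExtPlane, HasStabilizerA4 α ∧
        HasTetrahedralIndex (stab α) α (𝒮 ∩ {V, F}).ncard (𝒮 ∩ {E}).ncard 0 := by
    intro 𝒮 hS hle
    have hO : 𝒮 ⊆ {V, F, E} ∪ orbitsB stdGroup V F E := hS.trans Set.subset_union_left
    have hfin := h.finite_sUnion hO ((Set.toFinite _).subset hS)
    have hst : stab (⋃₀ 𝒮) = stdGroup := le_antisymm hle fun g hg =>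
      mem_stab_of_forall hfin fun x hx => h.smul_mem_sUnion hO hg hx
    have hindex := hasTetrahedralIndex_sUnion hG ht hS (Set.empty_subset _) Set.finite_empty
    rw [Set.union_empty, Set.ncard_empty] at hindex
    exact ⟨⋃₀ 𝒮, ⟨hfin, by rw [hst]; exact hG⟩, by rw [hst]; exact hindex⟩
  have hVE : V ≠ E := fun hh => by
    have := h.ncard_V
    rw [hh, h.ncard_E] at this
    omega
  have hFE : F ≠ E := fun hh => by
    have := h.ncard_F
    rw [hh, h.ncard_E] at this
    omega
  have hVF := h.V_ne_F
  obtain ⟨v, f, e, C, rfl, rfl, rfl⟩ := ht.exists_config hG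
  set V := Set.range v
  set F := Set.range f
  set E := {x | ∃ i j, i ≠ j ∧ e i j = x}
  interval_cases ε
  · have := key {V} (by simp) (by rw [Set.sUnion_singleton]; exact C.stab_range_v_le)
    rwa [show ({V} ∩ {V, F} : Set (Set ExtPlane)) = {V} by simp,
      show ({V} ∩ {E} : Set (Set ExtPlane)) = ∅ by simpa using hVE.symm, Set.ncard_singleton,
      Set.ncard_empty] at this
  · have := key {V, E} (by rintro O (rfl | rfl) <;> simp)
      (by rw [Set.sUnion_pair]; exact C.stab_v_union_e_le)
    have e1 : ({V, E} ∩ {V, F} : Set (Set ExtPlane)) = {V} := by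
      ext O
      constructor
      · rintro ⟨rfl | rfl, h2⟩
        · rfl
        · rcases h2 with h2 | h2
          exacts [absurd h2.symm hVE, absurd h2.symm hFE]
      · rintro rfl
        simp
    have e2 : ({V, E} ∩ {E} : Set (Set ExtPlane)) = {E} := by
      ext O
      simp
    rwa [e1, e2, Set.ncard_singleton, Set.ncard_singleton] at this

theorem exists_alpha_iff {ν ε k : ℕ} (hν : ν ≤ 2) (hε : ε ≤ 1) :
    (∃ α : Set ExtPlane, HasStabilizerA4 α ∧ HasTetrahedralIndex (stab α) α ν ε k) ↔
      1 ≤ k ∨ ν = 1 := by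
  constructor
  · rintro ⟨α, hα, h⟩
    by_contra! hcon
    obtain rfl : k = 0 := by omega
    have := h.ne_stab hα
    omega
  · rintro (hk | rfl)
    · exact exists_alpha_of_pos hν hε hk
    · rcases Nat.eq_zero_or_pos k with rfl | hk
      · exact exists_alpha_one hε
      · exact exists_alpha_of_pos hν hε hk

theorem HasStabilizerA4.exists_index {α : Set ExtPlane} (hα : HasStabilizerA4 α) :
    ∃ ν ε k, HasTetrahedralIndex (stab α) α ν ε k := by
  obtain ⟨V, F, E, ht⟩ := exists_isTetrahedralTriple hα.2
  exact exists_hasTetrahedralIndex hα.2 ht hα.1 fun g hg x hx => smul_mem_of_mem_stab hg hx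

end MoebiusStabilizer

/-! ### The theorem -/

theorem mainTheorem7 :
    (∀ α : Set MoebiusStabilizer.ExtPlane, MoebiusStabilizer.HasStabilizerA4 α →
      ∃! p : ℕ × ℕ × ℕ,
        MoebiusStabilizer.HasTetrahedralIndex (MoebiusStabilizer.stab α) α p.1 p.2.1 p.2.2) ∧
    (∀ ν ε k : ℕ, ν ≤ 2 → ε ≤ 1 →
      ((∃ α : Set MoebiusStabilizer.ExtPlane, MoebiusStabilizer.HasStabilizerA4 α ∧
          MoebiusStabilizer.HasTetrahedralIndex (MoebiusStabilizer.stab α) α ν ε k) ↔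
        (ν, ε, k) ∉ ({(0, 0, 0), (2, 0, 0), (0, 1, 0), (2, 1, 0)} : Set (ℕ × ℕ × ℕ)))) ∧
    (∀ (α : Set MoebiusStabilizer.ExtPlane) (ν ε k : ℕ), MoebiusStabilizer.HasStabilizerA4 α →
      MoebiusStabilizer.HasTetrahedralIndex (MoebiusStabilizer.stab α) α ν ε k →
      α.ncard = 4 * ν + 6 * ε + 12 * k) ∧
    {n : ℕ | ∃ α : Set MoebiusStabilizer.ExtPlane,
        MoebiusStabilizer.HasStabilizerA4 α ∧ α.ncard = n} =
      {n : ℕ | ∃ x ∈ ({0, 4, 6, 8, 10, 14} : Set ℕ), ∃ k : ℕ, 1 ≤ k ∧ n = x + 12 * k} ∪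
        {4, 10} := by
  open MoebiusStabilizer in
  refine ⟨fun α hα => ?_, fun ν ε k hν hε => ?_, fun α ν ε k _ h => h.ncard_eq, ?_⟩
  · obtain ⟨ν, ε, k, h⟩ := hα.exists_index
    refine ⟨(ν, ε, k), h, ?_⟩
    rintro ⟨ν', ε', k'⟩ h'
    obtain ⟨h1, h2, h3⟩ := h.eq_ncard
    obtain ⟨h1', h2', h3'⟩ := HasTetrahedralIndex.eq_ncard h'
    rw [Prod.mk.injEq, Prod.mk.injEq]
    exact ⟨h1'.trans h1.symm, h2'.trans h2.symm, h3'.trans h3.symm⟩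
  · rw [exists_alpha_iff hν hε]
    simp only [Set.mem_insert_iff, Set.mem_singleton_iff, Prod.mk.injEq]
    omega
  · ext n
    constructor
    · rintro ⟨α, hα, rfl⟩
      obtain ⟨ν, ε, k, h⟩ := hα.exists_index
      obtain ⟨hν, hε⟩ := h.le
      have hk := (exists_alpha_iff hν hε).1 ⟨α, hα, h⟩
      rw [h.ncard_eq]
      by_cases hk1 : 1 ≤ k
      · refine Or.inl ⟨4 * ν + 6 * ε, ?_, k, hk1, rfl⟩
        simp only [Set.mem_insert_iff, Set.mem_singleton_iff]
        omega
      -- With `k = 0` only `ν = 1` remains, giving the sporadic sizes `4` and `10`.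
      · right
        simp only [Set.mem_insert_iff, Set.mem_singleton_iff]
        omega
    · have key : ∀ ν ε k : ℕ, ν ≤ 2 → ε ≤ 1 → (1 ≤ k ∨ ν = 1) → n = 4 * ν + 6 * ε + 12 * k →
          ∃ α : Set ExtPlane, HasStabilizerA4 α ∧ α.ncard = n := by
        intro ν ε k hν hε hk hn
        obtain ⟨α, hα, h⟩ := (exists_alpha_iff hν hε).2 hk
        exact ⟨α, hα, h.ncard_eq.trans hn.symm⟩
      rintro (⟨x, hx, k, hk, rfl⟩ | hn)
      · rcases hx with rfl | rfl | rfl | rfl | rfl | rfl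
        · exact key 0 0 k (by omega) (by omega) (Or.inl hk) rfl
        · exact key 1 0 k (by omega) (by omega) (Or.inl hk) rfl
        · exact key 0 1 k (by omega) (by omega) (Or.inl hk) rfl
        · exact key 2 0 k (by omega) (by omega) (Or.inl hk) rfl
        · exact key 1 1 k (by omega) (by omega) (Or.inl hk) rfl
        · exact key 2 1 k (by omega) (by omega) (Or.inl hk) rfl
      · rcases hn with rfl | rfl
        · exact key 1 0 0 (by omega) (by omega) (Or.inr rfl) rfl
        · exact key 1 1 0 (by omega) (by omega) (Or.inr rfl) rfl
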